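/- Let $\mathbb E$ be a finite-dimensional real Euclidean space with inner product $(\cdot,\cdot)$, let $\Phi\subset\mathbb E$ be a finite reduced crystallographic root system (not required to span $\mathbb E$) with a simple base $\Delta$, and let $W$ be its Weyl group, the group generated by the reflections $s_\alpha$, $\alpha\in\Phi$ (which are orthogonal for $(\cdot,\cdot)$), with length function $\ell$ with respect to the simple reflections and Bruhat order $\le_B$. Let $\lambda\in\mathbb E$ be regular dominant, i.e. $(\lambda,\alpha^\vee)>0$ for every positive root $\alpha$, and let $c\in W$ be a Coxeter element, i.e. a product of all the simple reflections, each taken once, in some order. For $u\le_B v$ in $W$ put $P_{[u,v]}=\operatorname{conv}\{x\lambda : u\le_B x\le_B v\}$, and let $\mathrm{Perm}_W=\operatorname{conv}\{x\lambda : x\in W\}$. The moment complex of $c$ consists of the polytopes $w^{-1}P_{[w,wc]}$, for all $w\in W$ with $\ell(wc)=\ell(w)+\ell(c)$, together with all their nonempty faces. A *Coxeter matroid polytope* is a nonempty polytope contained in $\mathrm{Perm}_W$ whose vertices are vertices of $\mathrm{Perm}_W$ and all of whose edges are parallel to roots. It is a *$(W,c)$-polypositroid* if it is the solution set in $\mathbb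 E$ of finitely many inequalities $(x,n)\le a$ whose vectors $n$ have the property that $(\mathrm{id}-c)\,n$ is zero or a scalar multiple of a root. (It is zero exactly when $n$ is orthogonal to $\Phi$.) **Theorem.** Every nonempty face of every polytope in the moment complex of $c$ is a $(W,c)$-polypositroid. -/

import Mathlib

open scoped Pointwise RealInnerProductSpace

namespace CoxeterFlag

noncomputable section

section Combinatorics

variable {ι E N : Type*} [AddCommGroup E] [Module ℝ E] [AddCommGroup N] [Module ℝ N]
  {P : RootPairing ι ℝ E N}

/-- The length of an element of the Weyl group: the least number of factors in an expression as a
product of simple reflections. -/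
def length (b : P.Base) (w : P.weylGroup) : ℕ :=
  sInf {k : ℕ | ∃ l : List ι, (∀ i ∈ l, i ∈ b.support) ∧ l.length = k ∧
    (l.map (RootPairing.weylGroup.ofIdx P)).prod = w}

/-- The Bruhat order: the reflexive and transitive closure of the relations `t * y < y`, for `t` a
reflection with `length (t * y) < length y`. -/
def BruhatLE (b : P.Base) (u v : P.weylGroup) : Prop :=
  Relation.ReflTransGen
    (fun x y : P.weylGroup =>
      ∃ i : ι, x = RootPairing.weylGroup.ofIdx P i * y ∧ length b x < length b y) u v

/-- The Bruhat interval `[u, v]`. -/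
def bruhatInterval (b : P.Base) (u v : P.weylGroup) : Set P.weylGroup :=
  {x | BruhatLE b u x ∧ BruhatLE b x v}

/-- Coxeter elements: products of all the simple reflections, each taken once, in any order. -/
def IsCoxeterElement (b : P.Base) (c : P.weylGroup) : Prop :=
  ∃ l : List ι, l.Nodup ∧ (∀ i, i ∈ l ↔ i ∈ b.support) ∧
    c = (l.map (RootPairing.weylGroup.ofIdx P)).prod

/-- `lam` is regular dominant: it pairs positively with all positive coroots. -/
def IsRegularDominant (b : P.Base) (lam : E) : Prop :=
  ∀ i : ι, b.IsPos i → 0 < P.toLinearMap lam (P.coroot i)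

/-- The twisted Bruhat interval polytope `P_[u,v]`, the convex hull of `[u, v] · lam`. -/
def bruhatPolytope (b : P.Base) (lam : E) (u v : P.weylGroup) : Set E :=
  convexHull ℝ ((fun x : P.weylGroup => x • lam) '' bruhatInterval b u v)

/-- The `W`-permutahedron, the convex hull of the orbit of `lam`. -/
def permutahedron (P : RootPairing ι ℝ E N) (lam : E) : Set E :=
  convexHull ℝ (Set.range fun x : P.weylGroup => x • lam)

end Combinatorics

section Polytopes

variable {ι E N : Type*} [NormedAddCommGroup E] [InnerProductSpace ℝ E]
  [AddCommGroup N] [Module ℝ N] {P : RootPairing ι ℝ E N}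

/-- A (nonempty) face of a polytope `Q`: the set of maximizers on `Q` of some linear functional.
The zero functional shows that `Q` is a face of itself. -/
def IsFace (Q F : Set E) : Prop :=
  F.Nonempty ∧ IsExposed ℝ Q F

/-- The members of the moment complex of the Coxeter element `c`: all the translated polytopes
`w⁻¹ P_[w, w c]`, for `w` such that the product `w c` is length additive, and all their faces. -/
def momentComplex (b : P.Base) (lam : E) (c : P.weylGroup) : Set (Set E) :=
  {F | ∃ w : P.weylGroup, length b (w * c) = length b w + length b c ∧
    IsFace (w⁻¹ • bruhatPolytope b lam w (w * c)) F}

/-- Coxeter matroid polytopes: polytopes in the permutahedron, all of whose vertices are vertices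
of the permutahedron, and all of whose edges are parallel to roots. -/
structure IsCoxeterMatroidPolytope (P : RootPairing ι ℝ E N) (lam : E) (Q : Set E) : Prop where
  polytope : ∃ V : Set E, V.Finite ∧ V.Nonempty ∧ Q = convexHull ℝ V
  subset : Q ⊆ permutahedron P lam
  vertices : Q.extremePoints ℝ ⊆ (permutahedron P lam).extremePoints ℝ
  edges : ∀ x y : E, x ≠ y → IsFace Q (segment ℝ x y) → ∃ (i : ι) (r : ℝ), y - x = r • P.root i

/-- `(W, c)`-polypositroids: Coxeter matroid polytopes cut out by finitely many inequalities
`⟪x, n⟫ ≤ a` with `(id - c) n` a scalar multiple of a root. The multiple may be zero, which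
happens exactly when `n` is orthogonal to all roots: such inequalities only express that the
polytope lies in the affine span of the permutahedron, and are trivial when the roots span `E`.
The first alternative is written out separately only for the sake of the empty root system. -/
structure IsPolypositroid (lam : E) (c : P.weylGroup) (Q : Set E) : Prop where
  isCoxeterMatroidPolytope : IsCoxeterMatroidPolytope P lam Q
  inequalities : ∃ S : Finset (E × ℝ),
    (∀ p ∈ S, p.1 - c • p.1 = 0 ∨ ∃ (i : ι) (r : ℝ), p.1 - c • p.1 = r • P.root i) ∧
    Q = {x : E | ∀ p ∈ S, ⟪x, p.1⟫ ≤ p.2}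

end Polytopes

end

end CoxeterFlag

/-!
The polytopes of the moment complex are the translates by `w⁻¹` of the polytopes `P_[w, wc]`, and
the interval `[w, wc]` is *toric*: its length is the dimension of the moved space of `c`
(`IsCoxeterElement.isToric`). For a toric interval `[u, v]` the moved spaces add up independently
along chains (`IsToric.mov_right`, `IsToric.mov_left`), so every subinterval is toric, every Bruhat
relation inside `[u, v]` is a covering, and the moved space of `v u⁻¹` is the direction of the
affine span of `P_[u, v]`.

What has to be shown is that the facets of `P_[u, v]` come from the atoms and coatoms of `[u, v]`:
`P_[u, v]` is cut out, within its affine span, by the hyperplanes through `P_[a, v]` and `P_[u, b]`,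
for the atoms `a` and the coatoms `b`. A normal `h` of such a hyperplane is fixed by `v a⁻¹` or by
`b u⁻¹`. For `u = w` and `v = wc`, its translate `n = w⁻¹ h` is therefore fixed by `c r` for a
reflection `r`, and so `n - c n` is a multiple of a root (`mem_polypositroidNormals_of_fixed`).

These hyperplanes have to support `P_[u, v]`. At the atoms and coatoms this is a sign of the Euler
form: if `u r_i` is an atom and `v r_j` a coatom, for positive roots `i` and `j`, and if
`(id - u⁻¹ v) k = root i`, then `⟪k, root j⟫ ≥ 0` (`IsAtomCoatom.eulerNonneg`). The sign is proved
by induction along simple reflections; the main case is that of a diamond, in which one label is a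
nonnegative combination of two others (`exists_nonneg_combination`). It says that a functional
constant on `[a, v]`, and not smaller there than at `u`, is maximal at `v` among the coatoms
(`IsAtomCoatom.facet_atom`).

The rest is convex geometry of finite posets and is carried out for an abstract `IsToricPoset`. The
polytope of an interval lies in the cone at its top vertex generated by the coatoms
(`IsToricPoset.le_top`), hence on one side of every hyperplane considered
(`IsToricPoset.facet_atom_le`). Conversely, the line through a point satisfying all inequalities, in
the direction from the bottom to the top vertex, leaves the region through the hyperplane of an atom
and through that of a coatom; there the point satisfies the inequalities of `[a, v]` and of
`[u, b]`, and induction shows that it lies in the polytope (`IsToricPoset.mem_convexHull_iff`). The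
same description reduces an edge to a covering relation
(`IsToricPoset.exists_covBy_of_isExtreme`), so that edges are parallel to roots.

Finally, faces inherit everything: a face is cut out by the inequalities of the polytope and the
negatives of some of them (`IsCutOutBy.of_isFace`), and vertices and edges of a face are vertices
and edges of the polytope. All points of the orbit are vertices of the permutahedron, as they lie on
a sphere.
-/

open RootPairing
open RootPairing.weylGroup (ofIdx)
open scoped Pointwise RealInnerProductSpace

namespace CoxeterFlag

/-! ### Reflections, positive roots and the length function -/

section Length

variable {ι E N : Type*} [AddCommGroup E] [Module ℝ E] [AddCommGroup N] [Module ℝ N]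
  {P : RootPairing ι ℝ E N}

lemma ofIdx_smul_idx (i j : ι) : ofIdx P i • j = P.reflectionPerm i j := rfl

lemma root_smul_idx (g : P.weylGroup) (i : ι) : P.root (g • i) = g • P.root i :=
  (P.weylGroup_apply_root g i).symm

lemma ofIdx_smul_eq (i : ι) (x : E) :
    ofIdx P i • x = x - P.toLinearMap x (P.coroot i) • P.root i := by
  rw [weylGroup.ofIdx_smul, Equiv.reflection_smul, reflection_apply]
  rfl

lemma weylGroup_ext {g h : P.weylGroup} (H : ∀ x : E, g • x = h • x) : g = h := by
  apply Subtype.ext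
  apply Equiv.weightHom_injective P
  ext x
  exact H x

lemma ofIdx_mul_self (i : ι) : ofIdx P i * ofIdx P i = 1 := by
  apply weylGroup_ext
  intro x
  rw [mul_smul, one_smul]
  exact P.reflection_same i x

lemma ofIdx_inv (i : ι) : (ofIdx P i)⁻¹ = ofIdx P i :=
  inv_eq_of_mul_eq_one_right (ofIdx_mul_self i)

lemma ofIdx_mul_cancel_left (i : ι) (g : P.weylGroup) : ofIdx P i * (ofIdx P i * g) = g := by
  rw [← mul_assoc, ofIdx_mul_self, one_mul]

lemma mul_ofIdx_cancel_right (i : ι) (g : P.weylGroup) : g * ofIdx P i * ofIdx P i = g := by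
  rw [mul_assoc, ofIdx_mul_self, mul_one]

lemma conj_ofIdx (g : P.weylGroup) (i : ι) : g * ofIdx P i * g⁻¹ = ofIdx P (g • i) := by
  obtain ⟨g, hg⟩ := g
  induction hg using weylGroup.induction generalizing i with
  | mem j =>
    change ofIdx P j * ofIdx P i * (ofIdx P j)⁻¹ = ofIdx P (P.reflectionPerm j i)
    rw [ofIdx_inv]
    apply weylGroup_ext
    intro x
    rw [mul_smul, mul_smul]
    exact (LinearEquiv.congr_fun (P.reflection_reflectionPerm (i := i) (j := j)) x).symm
  | one =>
    change (1 : P.weylGroup) * ofIdx P i * 1⁻¹ = ofIdx P ((1 : P.weylGroup) • i)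
    simp
  | mul x y hx hy ihx ihy =>
    have h : (⟨x * y, mul_mem hx hy⟩ : P.weylGroup) = ⟨x, hx⟩ * ⟨y, hy⟩ := rfl
    rw [h, mul_smul, ← ihx, ← ihy]
    group

lemma ofIdx_mul (i : ι) (g : P.weylGroup) : ofIdx P i * g = g * ofIdx P (g⁻¹ • i) := by
  rw [← conj_ofIdx]; group

lemma mul_ofIdx (g : P.weylGroup) (i : ι) : g * ofIdx P i = ofIdx P (g • i) * g := by
  rw [← conj_ofIdx]; group

lemma smul_reflectionPerm_self (g : P.weylGroup) (i : ι) :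
    g • P.reflectionPerm i i = P.reflectionPerm (g • i) (g • i) := by
  apply P.root.injective
  rw [root_smul_idx, root_reflectionPerm, root_reflectionPerm, reflection_apply_self,
    reflection_apply_self, smul_neg, root_smul_idx]

lemma ofIdx_reflectionPerm_self (i : ι) : ofIdx P (P.reflectionPerm i i) = ofIdx P i := by
  rw [← ofIdx_smul_idx, ← conj_ofIdx]; group

lemma root_reflectionPerm_self (i : ι) : P.root (P.reflectionPerm i i) = -P.root i := by
  simp

variable (b : P.Base)

lemma isPos_reflectionPerm_self (i : ι) : b.IsPos (P.reflectionPerm i i) ↔ ¬ b.IsPos i :=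
  Base.IsPos.neg_iff_not b i

lemma isPos_smul_reflectionPerm_self (g : P.weylGroup) (i : ι) :
    b.IsPos (g • P.reflectionPerm i i) ↔ ¬ b.IsPos (g • i) := by
  rw [smul_reflectionPerm_self, isPos_reflectionPerm_self]

variable {b}

lemma exists_isPos_ofIdx_eq (b : P.Base) (i : ι) : ∃ j, b.IsPos j ∧ ofIdx P j = ofIdx P i := by
  by_cases h : b.IsPos i
  · exact ⟨i, h, rfl⟩
  · exact ⟨_, (isPos_reflectionPerm_self b i).2 h, ofIdx_reflectionPerm_self i⟩

/-- The product of the reflections in the list of roots `l`. -/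
noncomputable abbrev wordProd (P : RootPairing ι ℝ E N) (l : List ι) : P.weylGroup :=
  (l.map (ofIdx P)).prod

lemma wordProd_reverse (l : List ι) : wordProd P l.reverse = (wordProd P l)⁻¹ := by
  induction l with
  | nil => simp [wordProd]
  | cons a l ih =>
    simp only [wordProd, List.reverse_cons, List.map_append, List.prod_append, List.map_cons,
      List.map_nil, List.prod_cons, List.prod_nil, mul_one, mul_inv_rev, ofIdx_inv] at ih ⊢
    rw [ih]

lemma length_le (l : List ι) (hl : ∀ i ∈ l, i ∈ b.support) :
    length b (wordProd P l) ≤ l.length :=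
  Nat.sInf_le ⟨l, hl, rfl, rfl⟩

lemma length_one : length b (1 : P.weylGroup) = 0 := by
  simpa [wordProd] using length_le (P := P) (b := b) [] (by simp)

lemma length_simple_le {s : ι} (hs : s ∈ b.support) : length b (ofIdx P s) ≤ 1 := by
  simpa [wordProd] using length_le (P := P) (b := b) [s] (by simpa using hs)

lemma linearIndependent_of_isPos [P.IsReduced] {i j : ι} (hi : b.IsPos i) (hj : b.IsPos j)
    (hij : i ≠ j) : LinearIndependent ℝ ![P.root i, P.root j] := by
  refine IsReduced.linearIndependent P hij fun h' => ?_
  have : i = P.reflectionPerm j j := P.root.injective (by simpa using h')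
  rw [this] at hi
  exact (isPos_reflectionPerm_self b j).1 hi hj

lemma eq_of_ofIdx_eq [P.IsReduced] {i j : ι} (hi : b.IsPos i) (hj : b.IsPos j)
    (h : ofIdx P i = ofIdx P j) : i = j := by
  by_contra hne
  have hl := linearIndependent_of_isPos hi hj hne
  have h1 : ofIdx P i • P.root i = ofIdx P j • P.root i := by rw [h]
  rw [ofIdx_smul_eq, ofIdx_smul_eq] at h1
  have h2 := LinearIndependent.pair_iff.1 hl 2 (-P.toLinearMap (P.root i) (P.coroot j)) (by
    have h3 : P.toLinearMap (P.root i) (P.coroot i) = 2 := P.root_coroot_two i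
    rw [h3] at h1
    rw [neg_smul, ← sub_eq_add_neg, sub_eq_zero]
    exact sub_right_injective h1)
  norm_num at h2

variable [Finite ι] [P.IsCrystallographic] [P.IsReduced]

lemma isPos_simple_smul {s i : ι} (hs : s ∈ b.support) (hi : b.IsPos i) (his : i ≠ s) :
    b.IsPos (ofIdx P s • i) :=
  hi.reflectionPerm hs his

lemma exists_word (b : P.Base) (w : P.weylGroup) :
    ∃ l : List ι, (∀ i ∈ l, i ∈ b.support) ∧ wordProd P l = w := by
  obtain ⟨w, hw⟩ := w
  induction hw using weylGroup.induction with
  | mem i =>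
    refine b.induction_reflect i ?_ ?_ ?_
      (p := fun i => ∃ l : List ι, (∀ i ∈ l, i ∈ b.support) ∧ wordProd P l = ofIdx P i)
    · rintro i ⟨l, hl, h⟩
      exact ⟨l, hl, by rw [h, ofIdx_reflectionPerm_self]⟩
    · intro i hi
      exact ⟨[i], by simpa using hi, by simp [wordProd]⟩
    · rintro i j ⟨l, hl, h⟩ hj
      refine ⟨j :: (l ++ [j]), ?_, ?_⟩
      · intro k hk
        simp only [List.mem_cons, List.mem_append, List.not_mem_nil, or_false] at hk
        rcases hk with rfl | hk | rfl
        · exact hj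
        · exact hl k hk
        · exact hj
      · rw [← ofIdx_smul_idx, ← conj_ofIdx, ofIdx_inv, ← h]
        simp [wordProd, mul_assoc]
  | one => exact ⟨[], by simp, rfl⟩
  | mul x y hx hy ihx ihy =>
    obtain ⟨l, hl, h⟩ := ihx
    obtain ⟨l', hl', h'⟩ := ihy
    refine ⟨l ++ l', ?_, ?_⟩
    · intro k hk
      rcases List.mem_append.1 hk with hk | hk
      exacts [hl k hk, hl' k hk]
    · have e : (⟨x * y, mul_mem hx hy⟩ : P.weylGroup) = ⟨x, hx⟩ * ⟨y, hy⟩ := rfl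
      rw [e, ← h, ← h']
      simp [wordProd]

lemma exists_reduced_word (b : P.Base) (w : P.weylGroup) :
    ∃ l : List ι, (∀ i ∈ l, i ∈ b.support) ∧ l.length = length b w ∧ wordProd P l = w := by
  have : {k : ℕ | ∃ l : List ι, (∀ i ∈ l, i ∈ b.support) ∧ l.length = k ∧
      (l.map (ofIdx P)).prod = w}.Nonempty := by
    obtain ⟨l, hl, h⟩ := exists_word b w
    exact ⟨_, l, hl, rfl, h⟩
  exact Nat.sInf_mem this

lemma length_inv (w : P.weylGroup) : length b w⁻¹ = length b w := by
  have key : ∀ w : P.weylGroup, length b w⁻¹ ≤ length b w := by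
    intro w
    obtain ⟨l, hl, h1, h2⟩ := exists_reduced_word b w
    rw [← h1, ← h2, ← wordProd_reverse, ← List.length_reverse]
    exact length_le _ (by simpa using hl)
  refine le_antisymm (key w) ?_
  simpa using key w⁻¹

lemma length_mul_le (g h : P.weylGroup) : length b (g * h) ≤ length b g + length b h := by
  obtain ⟨l, hl, h1, h2⟩ := exists_reduced_word b g
  obtain ⟨l', hl', h1', h2'⟩ := exists_reduced_word b h
  have : g * h = wordProd P (l ++ l') := by rw [← h2, ← h2']; simp [wordProd]
  rw [this, ← h1, ← h1', ← List.length_append]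
  refine length_le _ fun k hk => ?_
  rcases List.mem_append.1 hk with hk | hk
  exacts [hl k hk, hl' k hk]

lemma eq_one_of_length_eq_zero {w : P.weylGroup} (h : length b w = 0) : w = 1 := by
  obtain ⟨l, _, h1, h2⟩ := exists_reduced_word b w
  rw [h, List.length_eq_zero_iff] at h1
  rw [← h2, h1]
  rfl

/-- The strong exchange condition: if the inverse of a word sends the positive root `i` to a
negative root, then the product of `r_i` and the word is obtained by deleting one letter of the
word. -/
lemma exists_word_ofIdx_mul (l : List ι) (hl : ∀ i ∈ l, i ∈ b.support) {i : ι} (hi : b.IsPos i)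
    (hneg : ¬ b.IsPos ((wordProd P l)⁻¹ • i)) :
    ∃ l' : List ι, (∀ i ∈ l', i ∈ b.support) ∧ l'.length + 1 = l.length ∧
      wordProd P l' = ofIdx P i * wordProd P l := by
  induction l generalizing i with
  | nil => simp [wordProd, hi] at hneg
  | cons s l ih =>
    have hs : s ∈ b.support := hl s (by simp)
    have hl' : ∀ i ∈ l, i ∈ b.support := fun j hj => hl j (by simp [hj])
    have e : wordProd P (s :: l) = ofIdx P s * wordProd P l := by simp [wordProd]
    by_cases his : i = s
    · subst his
      exact ⟨l, hl', by simp, by rw [e, ofIdx_mul_cancel_left]⟩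
    · rw [e, mul_inv_rev, ofIdx_inv, mul_smul] at hneg
      obtain ⟨l', h1, h2, h3⟩ := ih hl' (isPos_simple_smul hs hi his) hneg
      refine ⟨s :: l', ?_, by simp [h2], ?_⟩
      · intro k hk
        rcases List.mem_cons.1 hk with rfl | hk
        exacts [hs, h1 k hk]
      · have e' : wordProd P (s :: l') = ofIdx P s * wordProd P l' := by simp [wordProd]
        rw [e', e, h3, ← conj_ofIdx, ofIdx_inv]
        simp only [mul_assoc]
        rw [ofIdx_mul_cancel_left]

lemma length_ofIdx_mul_lt {w : P.weylGroup} {i : ι} (hi : b.IsPos i)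
    (hneg : ¬ b.IsPos (w⁻¹ • i)) : length b (ofIdx P i * w) < length b w := by
  obtain ⟨l, hl, h1, h2⟩ := exists_reduced_word b w
  rw [← h2] at hneg
  obtain ⟨l', h3, h4, h5⟩ := exists_word_ofIdx_mul l hl hi hneg
  have := length_le l' h3
  rw [h5, h2] at this
  omega

lemma length_ofIdx_mul_gt {w : P.weylGroup} {i : ι} (hi : b.IsPos i)
    (hpos : b.IsPos (w⁻¹ • i)) : length b w < length b (ofIdx P i * w) := by
  have h : ¬ b.IsPos ((ofIdx P i * w)⁻¹ • i) := by
    rw [mul_inv_rev, ofIdx_inv, mul_smul, ofIdx_smul_idx, isPos_smul_reflectionPerm_self]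
    simpa using hpos
  simpa [ofIdx_mul_cancel_left] using length_ofIdx_mul_lt hi h

lemma length_ofIdx_mul_lt_iff {w : P.weylGroup} {i : ι} (hi : b.IsPos i) :
    length b (ofIdx P i * w) < length b w ↔ ¬ b.IsPos (w⁻¹ • i) :=
  ⟨fun h h' => absurd (length_ofIdx_mul_gt hi h') (by omega), length_ofIdx_mul_lt hi⟩

lemma length_lt_ofIdx_mul_iff {w : P.weylGroup} {i : ι} (hi : b.IsPos i) :
    length b w < length b (ofIdx P i * w) ↔ b.IsPos (w⁻¹ • i) :=
  ⟨fun h => by_contra fun h' => absurd (length_ofIdx_mul_lt hi h') (by omega),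
    length_ofIdx_mul_gt hi⟩

lemma length_mul_ofIdx_lt_iff {w : P.weylGroup} {i : ι} (hi : b.IsPos i) :
    length b (w * ofIdx P i) < length b w ↔ ¬ b.IsPos (w • i) := by
  have := length_ofIdx_mul_lt_iff (w := w⁻¹) hi
  rwa [← length_inv, mul_inv_rev, ofIdx_inv, inv_inv, length_inv] at this

lemma length_lt_mul_ofIdx_iff {w : P.weylGroup} {i : ι} (hi : b.IsPos i) :
    length b w < length b (w * ofIdx P i) ↔ b.IsPos (w • i) := by
  have := length_lt_ofIdx_mul_iff (w := w⁻¹) hi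
  rwa [length_inv, ← length_inv (w := ofIdx P i * _), mul_inv_rev, ofIdx_inv, inv_inv] at this

lemma length_ofIdx_mul_ne (w : P.weylGroup) (i : ι) :
    length b (ofIdx P i * w) ≠ length b w := by
  obtain ⟨j, hj, h⟩ := exists_isPos_ofIdx_eq b i
  rw [← h]
  by_cases hp : b.IsPos (w⁻¹ • j)
  · exact (length_ofIdx_mul_gt hj hp).ne'
  · exact (length_ofIdx_mul_lt hj hp).ne

lemma length_simple_mul {s : ι} (hs : s ∈ b.support) (w : P.weylGroup) :
    length b (ofIdx P s * w) = length b w + 1 ∨ length b (ofIdx P s * w) + 1 = length b w := by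
  have h1 := length_mul_le (b := b) (ofIdx P s) w
  have h2 := length_mul_le (b := b) (ofIdx P s) (ofIdx P s * w)
  rw [ofIdx_mul_cancel_left] at h2
  have h3 := length_simple_le (P := P) hs
  have h4 := length_ofIdx_mul_ne (b := b) w s
  omega

lemma exists_left_descent {w : P.weylGroup} (hw : w ≠ 1) :
    ∃ s ∈ b.support, length b (ofIdx P s * w) < length b w := by
  obtain ⟨l, hl, h1, h2⟩ := exists_reduced_word b w
  cases l with
  | nil => exact absurd h2.symm hw
  | cons s l =>
    refine ⟨s, hl s (by simp), ?_⟩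
    have : ofIdx P s * w = wordProd P l := by
      rw [← h2]; simp [wordProd, ofIdx_mul_cancel_left]
    rw [this, ← h1]
    exact Nat.lt_succ_of_le (length_le l fun j hj => hl j (by simp [hj]))

end Length

/-! ### The Bruhat order -/

section Bruhat

variable {ι E N : Type*} [AddCommGroup E] [Module ℝ E] [AddCommGroup N] [Module ℝ N]
  {P : RootPairing ι ℝ E N}

/-- The relation generating the Bruhat order: `x` is obtained from `y` by left multiplication with
a reflection that lowers the length (by an arbitrary amount). -/
def BruhatStep (b : P.Base) (x y : P.weylGroup) : Prop :=
  ∃ i : ι, x = ofIdx P i * y ∧ length b x < length b y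

variable {b : P.Base} {u v w x y : P.weylGroup}

lemma BruhatStep.length_lt (h : BruhatStep b x y) : length b x < length b y := h.choose_spec.2

lemma BruhatStep.le (h : BruhatStep b x y) : BruhatLE b x y := Relation.ReflTransGen.single h

lemma BruhatLE.refl (b : P.Base) (x : P.weylGroup) : BruhatLE b x x := Relation.ReflTransGen.refl

lemma BruhatLE.trans (h : BruhatLE b x y) (h' : BruhatLE b y w) : BruhatLE b x w :=
  Relation.ReflTransGen.trans h h'

lemma BruhatLE.eq_or_length_lt (h : BruhatLE b x y) : x = y ∨ length b x < length b y := by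
  induction h with
  | refl => exact Or.inl rfl
  | tail _ h ih =>
    have := BruhatStep.length_lt h
    rcases ih with rfl | ih
    · exact Or.inr this
    · exact Or.inr (ih.trans this)

lemma BruhatLE.length_le (h : BruhatLE b x y) : length b x ≤ length b y := by
  rcases h.eq_or_length_lt with rfl | h
  exacts [le_rfl, h.le]

lemma BruhatLE.eq_of_length_le (h : BruhatLE b x y) (hl : length b y ≤ length b x) : x = y :=
  h.eq_or_length_lt.resolve_right hl.not_gt

lemma BruhatLE.antisymm (h : BruhatLE b x y) (h' : BruhatLE b y x) : x = y :=
  h.eq_of_length_le h'.length_le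

lemma BruhatLE.exists_step_left (h : BruhatLE b x y) (hne : x ≠ y) :
    ∃ z, BruhatStep b x z ∧ BruhatLE b z y := by
  rcases Relation.ReflTransGen.cases_head h with h | ⟨z, h1, h2⟩
  exacts [absurd h hne, ⟨z, h1, h2⟩]

lemma BruhatLE.step_of_length (h : BruhatLE b x y) (hl : length b y = length b x + 1) :
    BruhatStep b x y := by
  obtain ⟨z, h1, h2⟩ := h.exists_step_left (by rintro rfl; omega)
  have := h1.length_lt
  rwa [← h2.eq_of_length_le (by omega)]

lemma bruhatStep_ofIdx_mul {i : ι} (h : length b (ofIdx P i * x) < length b x) :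
    BruhatStep b (ofIdx P i * x) x := ⟨i, rfl, h⟩

lemma bruhatStep_of_lt_ofIdx_mul {i : ι} (h : length b x < length b (ofIdx P i * x)) :
    BruhatStep b x (ofIdx P i * x) := ⟨i, (ofIdx_mul_cancel_left i x).symm, h⟩

lemma bruhatStep_mul_ofIdx {i : ι} (h : length b (x * ofIdx P i) < length b x) :
    BruhatStep b (x * ofIdx P i) x := ⟨_, mul_ofIdx x i, h⟩

lemma bruhatStep_of_lt_mul_ofIdx {i : ι} (h : length b x < length b (x * ofIdx P i)) :
    BruhatStep b x (x * ofIdx P i) := by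
  refine ⟨x • i, ?_, h⟩
  rw [mul_ofIdx, ofIdx_mul_cancel_left]

lemma BruhatStep.exists_right_root (h : BruhatStep b x y) :
    ∃ i, b.IsPos i ∧ y = x * ofIdx P i ∧ x = y * ofIdx P i := by
  obtain ⟨i, rfl, -⟩ := h
  obtain ⟨j, hj, hj'⟩ := exists_isPos_ofIdx_eq b (y⁻¹ • i)
  have : ofIdx P i * y = y * ofIdx P j := by rw [ofIdx_mul, hj']
  exact ⟨j, hj, by rw [this, mul_ofIdx_cancel_right], this⟩

lemma BruhatStep.exists_left_root (h : BruhatStep b x y) :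
    ∃ i, b.IsPos i ∧ y = ofIdx P i * x ∧ x = ofIdx P i * y := by
  obtain ⟨i, rfl, -⟩ := h
  obtain ⟨j, hj, hj'⟩ := exists_isPos_ofIdx_eq b i
  exact ⟨j, hj, by rw [hj', ofIdx_mul_cancel_left], by rw [hj']⟩

variable [Finite ι] [P.IsCrystallographic] [P.IsReduced]

lemma BruhatStep.inv (h : BruhatStep b x y) : BruhatStep b x⁻¹ y⁻¹ := by
  have hl := h.length_lt
  obtain ⟨i, -, -, rfl⟩ := h.exists_left_root
  rw [← length_inv, ← length_inv (w := y)] at hl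
  rw [mul_inv_rev, ofIdx_inv] at hl ⊢
  exact bruhatStep_mul_ofIdx hl

lemma BruhatLE.inv (h : BruhatLE b x y) : BruhatLE b x⁻¹ y⁻¹ := by
  induction h with
  | refl => exact BruhatLE.refl _ _
  | tail _ h ih => exact ih.trans (BruhatStep.inv h).le

lemma length_simple_mul_of_not_lt {s : ι} (hs : s ∈ b.support) {w : P.weylGroup}
    (h : ¬ length b (ofIdx P s * w) < length b w) : length b (ofIdx P s * w) = length b w + 1 := by
  rcases length_simple_mul hs w with h' | h' <;> omega

lemma length_simple_mul_of_lt {s : ι} (hs : s ∈ b.support) {w : P.weylGroup}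
    (h : length b (ofIdx P s * w) < length b w) : length b (ofIdx P s * w) + 1 = length b w := by
  rcases length_simple_mul hs w with h' | h' <;> omega

/-- Left multiplication by a simple reflection `s` respects the generating relation of the Bruhat
order, except where it exchanges the two elements: `s` preserves the positivity of all positive
roots but the simple one. -/
lemma BruhatStep.simple_mul {s : ι} (hs : s ∈ b.support) (h : BruhatStep b x y)
    (hne : x ≠ ofIdx P s * y) : BruhatStep b (ofIdx P s * x) (ofIdx P s * y) := by
  have hl := h.length_lt
  obtain ⟨i, hi, -, rfl⟩ := h.exists_left_root
  have his : i ≠ s := by rintro rfl; exact hne rfl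
  rw [length_ofIdx_mul_lt_iff hi] at hl
  have e : ofIdx P s * (ofIdx P i * y) = ofIdx P (ofIdx P s • i) * (ofIdx P s * y) := by
    rw [← conj_ofIdx]; group
  rw [e]
  refine bruhatStep_ofIdx_mul ((length_ofIdx_mul_lt_iff (isPos_simple_smul hs hi his)).2 ?_)
  rwa [mul_inv_rev, mul_smul, inv_smul_smul]

lemma BruhatLE.simple_mul_le_or {s : ι} (hs : s ∈ b.support) (h : BruhatLE b u v) :
    BruhatLE b (ofIdx P s * u) v ∨ BruhatLE b (ofIdx P s * u) (ofIdx P s * v) := by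
  induction h using Relation.ReflTransGen.head_induction_on with
  | refl => exact Or.inr (BruhatLE.refl _ _)
  | @head x z h h' ih =>
    by_cases hne : x = ofIdx P s * z
    · rw [hne, ofIdx_mul_cancel_left]; exact Or.inl h'
    · have := (BruhatStep.simple_mul hs h hne).le
      exact ih.imp this.trans this.trans

lemma BruhatLE.le_simple_mul_or {s : ι} (hs : s ∈ b.support) (h : BruhatLE b u v) :
    BruhatLE b u (ofIdx P s * v) ∨ BruhatLE b (ofIdx P s * u) (ofIdx P s * v) := by
  induction h with
  | refl => exact Or.inr (BruhatLE.refl _ _)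
  | @tail z y h' h ih =>
    by_cases hne : z = ofIdx P s * y
    · rw [← hne]; exact Or.inl h'
    · have := (BruhatStep.simple_mul hs h hne).le
      exact ih.imp (·.trans this) (·.trans this)

/-- The lifting property, first form. -/
lemma BruhatLE.simple_mul_le {s : ι} (hs : s ∈ b.support) (h : BruhatLE b u v)
    (hv : length b (ofIdx P s * v) < length b v) : BruhatLE b (ofIdx P s * u) v :=
  (h.simple_mul_le_or hs).elim id (·.trans (bruhatStep_ofIdx_mul hv).le)

/-- The lifting property, second form. -/
lemma BruhatLE.le_simple_mul {s : ι} (hs : s ∈ b.support) (h : BruhatLE b u v)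
    (hu : length b u < length b (ofIdx P s * u)) : BruhatLE b u (ofIdx P s * v) :=
  (h.le_simple_mul_or hs).elim id ((bruhatStep_of_lt_ofIdx_mul hu).le.trans ·)

/-- The lifting property, third form. -/
lemma BruhatLE.simple_mul_le_simple_mul {s : ι} (hs : s ∈ b.support) (h : BruhatLE b u v)
    (hu : length b (ofIdx P s * u) < length b u) :
    BruhatLE b (ofIdx P s * u) (ofIdx P s * v) :=
  (h.le_simple_mul_or hs).elim ((bruhatStep_ofIdx_mul hu).le.trans ·) id

/-- Bruhat intervals of length two have at least two middle elements. -/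
lemma exists_ne_middle {u m v : P.weylGroup} (h1 : BruhatStep b u m) (h2 : BruhatStep b m v)
    (hl : length b v = length b u + 2) :
    ∃ m', m' ≠ m ∧ BruhatStep b u m' ∧ BruhatStep b m' v := by
  induction hn : length b v using Nat.strong_induction_on generalizing u m v with
  | _ n ih =>
  subst hn
  have hv1 : v ≠ 1 := by
    rintro rfl
    rw [length_one] at hl
    omega
  have huv : u ≠ v := by rintro rfl; omega
  obtain ⟨s, hs, hsv⟩ := exists_left_descent (b := b) hv1
  have hsv' := length_simple_mul_of_lt hs hsv
  have huv' := h1.le.trans h2.le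
  have hm1 := h1.length_lt
  have hm2 := h2.length_lt
  by_cases hsu : length b (ofIdx P s * u) < length b u
  · have hsu' := length_simple_mul_of_lt hs hsu
    have key : ∀ q, q ≠ u → BruhatStep b (ofIdx P s * u) q → BruhatStep b q (ofIdx P s * v) →
        BruhatStep b u (ofIdx P s * q) ∧ BruhatStep b (ofIdx P s * q) v := by
      intro q hqu h3 h4
      constructor
      · have := h3.simple_mul hs (fun h => hqu (mul_left_cancel h).symm)
        rwa [ofIdx_mul_cancel_left] at this
      · have := h4.simple_mul hs (by
          rw [ofIdx_mul_cancel_left]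
          rintro rfl
          exact absurd h4.length_lt (by omega))
        rwa [ofIdx_mul_cancel_left] at this
    by_cases hm : m = ofIdx P s * v
    · obtain ⟨q, hq, h3, h4⟩ := ih _ hsv (bruhatStep_ofIdx_mul hsu) (hm ▸ h1) (by omega) rfl
      refine ⟨_, ?_, key q hq h3 h4⟩
      rw [hm]
      intro h
      have := mul_left_cancel h
      rw [this] at h4
      exact absurd h4.length_lt (by omega)
    · obtain ⟨q, hq, h3, h4⟩ := ih _ hsv
        (h1.simple_mul hs (by
          intro h
          rw [h, ofIdx_mul_cancel_left] at hsu
          rw [← h] at hsu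
          omega))
        (h2.simple_mul hs hm) (by omega) rfl
      by_cases hqu : q = u
      · subst hqu
        exact ⟨_, fun h => hm h.symm, h4, bruhatStep_ofIdx_mul hsv⟩
      · refine ⟨_, ?_, key q hqu h3 h4⟩
        rintro rfl
        exact hq (ofIdx_mul_cancel_left s q).symm
  · have hsu' := length_simple_mul_of_not_lt hs hsu
    have e1 : BruhatStep b u (ofIdx P s * u) := bruhatStep_of_lt_ofIdx_mul (by omega)
    have e2 : BruhatStep b (ofIdx P s * v) v := bruhatStep_ofIdx_mul hsv
    have e3 : BruhatStep b (ofIdx P s * u) v :=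
      (huv'.simple_mul_le hs hsv).step_of_length (by omega)
    have e4 : BruhatStep b u (ofIdx P s * v) :=
      (huv'.le_simple_mul hs (by omega)).step_of_length (by omega)
    by_cases hm : ofIdx P s * u = m
    · refine ⟨_, ?_, e4, e2⟩
      rw [← hm]
      exact fun h => huv (mul_left_cancel h).symm
    · exact ⟨_, hm, e1, e3⟩

end Bruhat

/-! ### Moved spaces and toric intervals -/

section Mov

variable {ι E N : Type*} [AddCommGroup E] [Module ℝ E] [AddCommGroup N] [Module ℝ N]
  {P : RootPairing ι ℝ E N}

/-- The moved space of a Weyl group element `g`, the image of `id - g`. -/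
noncomputable def mov (g : P.weylGroup) : Submodule ℝ E :=
  LinearMap.range (LinearMap.id - DistribSMul.toLinearMap ℝ E g)

variable {g h : P.weylGroup}

lemma mem_mov {x : E} : x ∈ mov g ↔ ∃ y, y - g • y = x := Iff.rfl

lemma sub_smul_mem_mov (g : P.weylGroup) (y : E) : y - g • y ∈ mov g := ⟨y, rfl⟩

lemma smul_sub_mem_mov (g : P.weylGroup) (y : E) : g • y - y ∈ mov g := by
  rw [← neg_sub]; exact neg_mem (sub_smul_mem_mov g y)

lemma mov_one : mov (1 : P.weylGroup) = ⊥ := by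
  rw [eq_bot_iff]
  rintro x ⟨y, rfl⟩
  simp

lemma mov_mul_le (g h : P.weylGroup) : mov (g * h) ≤ mov g ⊔ mov h := by
  rintro x ⟨y, rfl⟩
  have : y - (g * h) • y = (h • y - g • (h • y)) + (y - h • y) := by rw [mul_smul]; abel
  change y - (g * h) • y ∈ _
  rw [this]
  exact Submodule.add_mem_sup (sub_smul_mem_mov g _) (sub_smul_mem_mov h y)

lemma mov_ofIdx (i : ι) : mov (ofIdx P i) = Submodule.span ℝ {P.root i} := by
  apply le_antisymm
  · rintro x ⟨y, rfl⟩
    change y - ofIdx P i • y ∈ _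
    rw [ofIdx_smul_eq, sub_sub_cancel]
    exact Submodule.smul_mem _ _ (Submodule.mem_span_singleton_self _)
  · rw [Submodule.span_singleton_le_iff_mem]
    refine ⟨(1 / 2 : ℝ) • P.root i, ?_⟩
    change (1 / 2 : ℝ) • P.root i - ofIdx P i • ((1 / 2 : ℝ) • P.root i) = _
    rw [ofIdx_smul_eq, map_smul, LinearMap.smul_apply, P.root_coroot_two]
    simp

lemma mov_conj (g h : P.weylGroup) :
    mov (g * h * g⁻¹) = (mov h).map (DistribMulAction.toLinearEquiv ℝ E g : E →ₗ[ℝ] E) := by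
  ext x
  simp only [mem_mov, Submodule.mem_map]
  constructor
  · rintro ⟨y, rfl⟩
    refine ⟨_, ⟨g⁻¹ • y, rfl⟩, ?_⟩
    change g • (g⁻¹ • y - h • g⁻¹ • y) = _
    rw [smul_sub, smul_inv_smul, mul_smul, mul_smul]
  · rintro ⟨-, ⟨y, rfl⟩, rfl⟩
    refine ⟨g • y, ?_⟩
    change _ = g • (y - h • y)
    rw [smul_sub, mul_smul, mul_smul, inv_smul_smul]

lemma finrank_mov_conj (g h : P.weylGroup) :
    Module.finrank ℝ (mov (g * h * g⁻¹)) = Module.finrank ℝ (mov h) := by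
  rw [mov_conj]
  exact LinearEquiv.finrank_map_eq _ _

lemma finrank_mov_ofIdx_le (i : ι) : Module.finrank ℝ (mov (ofIdx P i)) ≤ 1 := by
  rw [mov_ofIdx]
  exact (finrank_span_le_card _).trans (by simp)

/-- An interval `[u, v]` of the Bruhat order is toric if its length is (at most) the dimension of
the moved space of `u⁻¹ v`. Then the roots of any saturated chain from `u` to `v` are linearly
independent. -/
def IsToric (b : P.Base) (u v : P.weylGroup) : Prop :=
  BruhatLE b u v ∧ length b v ≤ length b u + Module.finrank ℝ (mov (u⁻¹ * v))

variable {b : P.Base} {u v x y : P.weylGroup}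

lemma IsToric.le (h : IsToric b u v) : BruhatLE b u v := h.1

lemma BruhatStep.finrank_mov_le (h : BruhatStep b x y) :
    Module.finrank ℝ (mov (x⁻¹ * y)) ≤ 1 := by
  obtain ⟨i, -, hy, -⟩ := h.exists_right_root
  rw [hy, inv_mul_cancel_left]
  exact finrank_mov_ofIdx_le i

section FiniteDimensional

variable [FiniteDimensional ℝ E]

lemma finrank_mov_mul_le (g h : P.weylGroup) :
    Module.finrank ℝ (mov (g * h)) ≤ Module.finrank ℝ (mov g) + Module.finrank ℝ (mov h) :=
  (Submodule.finrank_mono (mov_mul_le g h)).trans (Submodule.finrank_add_le_finrank_add_finrank _ _)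

lemma mov_mul_eq_sup (h1 : Module.finrank ℝ (mov g) + Module.finrank ℝ (mov h) ≤
    Module.finrank ℝ (mov (g * h))) : mov (g * h) = mov g ⊔ mov h ∧ Disjoint (mov g) (mov h) := by
  have h2 := Submodule.finrank_mono (mov_mul_le g h)
  have h3 := Submodule.finrank_sup_add_finrank_inf_eq (mov g) (mov h)
  refine ⟨Submodule.eq_of_le_of_finrank_le (mov_mul_le g h) (by omega), ?_⟩
  rw [disjoint_iff, ← Submodule.finrank_eq_zero (R := ℝ)]
  omega

lemma BruhatLE.finrank_mov_add_le (h : BruhatLE b u v) :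
    length b u + Module.finrank ℝ (mov (u⁻¹ * v)) ≤ length b v := by
  induction h with
  | refl => simp [mov_one]
  | @tail x y _ h ih =>
    have h1 := BruhatStep.length_lt h
    have h2 := BruhatStep.finrank_mov_le h
    have h3 := finrank_mov_mul_le (u⁻¹ * x) (x⁻¹ * y)
    rw [show u⁻¹ * x * (x⁻¹ * y) = u⁻¹ * y by group] at h3
    omega

lemma IsToric.finrank_mov_mul (h : IsToric b u v) (h1 : BruhatLE b u x) (h2 : BruhatLE b x v) :
    Module.finrank ℝ (mov (u⁻¹ * x)) + Module.finrank ℝ (mov (x⁻¹ * v)) ≤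
      Module.finrank ℝ (mov (u⁻¹ * v)) := by
  have := h.2
  have := h1.finrank_mov_add_le
  have := h2.finrank_mov_add_le
  omega

lemma IsToric.left (h : IsToric b u v) (h1 : BruhatLE b u x) (h2 : BruhatLE b x v) :
    IsToric b u x := by
  refine ⟨h1, ?_⟩
  have h3 := finrank_mov_mul_le (u⁻¹ * x) (x⁻¹ * v)
  rw [show u⁻¹ * x * (x⁻¹ * v) = u⁻¹ * v by group] at h3
  have := h.2
  have := h2.finrank_mov_add_le
  omega

lemma IsToric.right (h : IsToric b u v) (h1 : BruhatLE b u x) (h2 : BruhatLE b x v) :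
    IsToric b x v := by
  refine ⟨h2, ?_⟩
  have h3 := finrank_mov_mul_le (u⁻¹ * x) (x⁻¹ * v)
  rw [show u⁻¹ * x * (x⁻¹ * v) = u⁻¹ * v by group] at h3
  have := h.2
  have := h1.finrank_mov_add_le
  omega

lemma IsToric.mov_right (h : IsToric b u v) (h1 : BruhatLE b u x) (h2 : BruhatLE b x v) :
    mov (u⁻¹ * v) = mov (u⁻¹ * x) ⊔ mov (x⁻¹ * v) ∧
      Disjoint (mov (u⁻¹ * x)) (mov (x⁻¹ * v)) := by
  have e : u⁻¹ * v = u⁻¹ * x * (x⁻¹ * v) := by group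
  have := h.finrank_mov_mul h1 h2
  rw [e] at this ⊢
  exact mov_mul_eq_sup this

lemma IsToric.mov_left (h : IsToric b u v) (h1 : BruhatLE b u x) (h2 : BruhatLE b x v) :
    mov (v * u⁻¹) = mov (v * x⁻¹) ⊔ mov (x * u⁻¹) ∧
      Disjoint (mov (v * x⁻¹)) (mov (x * u⁻¹)) := by
  have e : v * u⁻¹ = v * x⁻¹ * (x * u⁻¹) := by group
  have h3 := h.finrank_mov_mul h1 h2
  have key : ∀ p q : P.weylGroup, Module.finrank ℝ (mov (p⁻¹ * q)) =
      Module.finrank ℝ (mov (q * p⁻¹)) := by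
    intro p q
    rw [← finrank_mov_conj p (p⁻¹ * q)]
    congr 3
    group
  rw [key, key, key u v] at h3
  rw [e] at h3 ⊢
  exact mov_mul_eq_sup (by omega)

lemma IsToric.length_step (h : IsToric b u v) (h1 : BruhatLE b u x) (h2 : BruhatStep b x y)
    (h3 : BruhatLE b y v) : length b y = length b x + 1 := by
  have h4 := ((h.right h1 (h2.le.trans h3)).left h2.le h3).2
  have := h2.finrank_mov_le
  have := h2.length_lt
  omega

end FiniteDimensional

end Mov

/-! ### Signs of atoms against coatoms in a toric interval -/

section AwayFrom

variable {ι E N : Type*} [AddCommGroup E] [Module ℝ E] [AddCommGroup N] [Module ℝ N]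
  {P : RootPairing ι ℝ E N} {b : P.Base}

/-- The height away from a simple root `p`: the sum of the coefficients at the other simple
roots. -/
lemma exists_height_away [P.IsReduced] (p : ι) (hp : p ∈ b.support) :
    ∃ f : E →ₗ[ℝ] ℝ, f (P.root p) = 0 ∧ ∀ i, b.IsPos i → i ≠ p → 0 < f (P.root i) := by
  classical
  have hli : LinearIndependent ℝ (fun i : b.support => P.root i) := b.linearIndepOn_root
  obtain ⟨f, hf⟩ := LinearMap.exists_extend
    (p := Submodule.span ℝ (Set.range fun i : b.support => P.root i))
    ((Module.Basis.span hli).constr ℝ (fun i : b.support => if (i : ι) = p then (0 : ℝ) else 1))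
  have hf' : ∀ i ∈ b.support, f (P.root i) = if i = p then 0 else 1 := by
    intro i hi
    have h1 := (Module.Basis.span hli).constr_basis ℝ
      (fun i : b.support => if (i : ι) = p then (0 : ℝ) else 1) ⟨i, hi⟩
    rw [← hf] at h1
    rw [← h1, LinearMap.comp_apply, Submodule.subtype_apply, Module.Basis.span_apply]
  refine ⟨f, by simp [hf' p hp], fun i hi hip => ?_⟩
  obtain ⟨c, -, hc, hsum⟩ := b.exists_root_eq_sum_int i
  have hc0 : ∀ j, 0 ≤ c j := by
    rcases hc with hc | hc
    · exact hc.le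
    · exfalso
      rw [Base.isPos_iff, Base.height_eq_sum hsum] at hi
      exact absurd hi (Finset.sum_nonpos fun j _ => hc.le j).not_gt
  have hfi : f (P.root i) = ∑ j ∈ b.support, (c j : ℝ) * if j = p then 0 else 1 := by
    conv_lhs => rw [hsum]
    rw [map_sum]
    refine Finset.sum_congr rfl fun j hj => ?_
    rw [← hf' j hj, map_zsmul, zsmul_eq_mul]
  have hnn : ∀ j ∈ b.support, 0 ≤ (c j : ℝ) * if j = p then 0 else 1 := by
    intro j _
    have : (0 : ℝ) ≤ c j := by exact_mod_cast hc0 j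
    split_ifs <;> simp [this]
  rw [hfi]
  refine (Finset.sum_nonneg hnn).lt_of_ne fun h0 => ?_
  have h1 := (Finset.sum_eq_zero_iff_of_nonneg hnn).1 h0.symm
  have h2 : P.root i = c p • P.root p := by
    rw [hsum]
    refine Finset.sum_eq_single_of_mem p hp fun j hj hjp => ?_
    have := h1 j hj
    simp only [hjp, if_false, mul_one, Int.cast_eq_zero] at this
    rw [this, zero_smul]
  have h3 := LinearIndependent.pair_iff.1
    (linearIndependent_of_isPos hi (b.isPos_of_mem_support hp) hip) 1 (-(c p : ℝ)) (by
      rw [h2, one_smul, neg_smul, Int.cast_smul_eq_zsmul, add_neg_cancel])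
  norm_num at h3

end AwayFrom

section Isometry

variable {ι E N : Type*} [NormedAddCommGroup E] [InnerProductSpace ℝ E]
  [AddCommGroup N] [Module ℝ N] {P : RootPairing ι ℝ E N}

lemma inner_smul_smul (hP : ∀ (i : ι) (x y : E), ⟪P.reflection i x, P.reflection i y⟫ = ⟪x, y⟫)
    (g : P.weylGroup) (x y : E) : ⟪g • x, g • y⟫ = ⟪x, y⟫ := by
  obtain ⟨g, hg⟩ := g
  induction hg using weylGroup.induction generalizing x y with
  | mem i => exact hP i x y
  | one => rfl
  | mul g h hg hh ihg ihh =>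
    have e : (⟨g * h, mul_mem hg hh⟩ : P.weylGroup) = ⟨g, hg⟩ * ⟨h, hh⟩ := rfl
    rw [e, mul_smul, mul_smul, ihg, ihh]

lemma inner_smul_eq (hP : ∀ (i : ι) (x y : E), ⟪P.reflection i x, P.reflection i y⟫ = ⟪x, y⟫)
    (g : P.weylGroup) (x y : E) : ⟪g • x, y⟫ = ⟪x, g⁻¹ • y⟫ := by
  rw [← inner_smul_smul hP g x, smul_inv_smul]

lemma inner_root_self_pos (i : ι) : 0 < ⟪P.root i, P.root i⟫ :=
  real_inner_self_pos.2 (P.ne_zero i)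

lemma coroot_mul_inner (hP : ∀ (i : ι) (x y : E), ⟪P.reflection i x, P.reflection i y⟫ = ⟪x, y⟫)
    (i : ι) (x : E) :
    P.toLinearMap x (P.coroot i) * ⟪P.root i, P.root i⟫ = 2 * ⟪x, P.root i⟫ := by
  have h := hP i x (P.root i)
  rw [reflection_apply_self, reflection_apply, inner_neg_right, inner_sub_left,
    real_inner_smul_left] at h
  change -(⟪x, P.root i⟫ - P.toLinearMap x (P.coroot i) * _) = _ at h
  linarith

lemma mem_mov_orthogonal
    (hP : ∀ (i : ι) (x y : E), ⟪P.reflection i x, P.reflection i y⟫ = ⟪x, y⟫)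
    {g : P.weylGroup} {x : E} : x ∈ (mov g)ᗮ ↔ g • x = x := by
  rw [Submodule.mem_orthogonal]
  constructor
  · intro h
    have h1 : ∀ y, ⟪y, x - g⁻¹ • x⟫ = 0 := by
      intro y
      have := h _ (sub_smul_mem_mov g y)
      rwa [inner_sub_left, inner_smul_eq hP, ← inner_sub_right] at this
    have h2 := h1 (x - g⁻¹ • x)
    rw [inner_self_eq_zero, sub_eq_zero] at h2
    conv_lhs => rw [h2, smul_inv_smul]
  · rintro h _ ⟨y, rfl⟩
    change ⟪y - g • y, x⟫ = 0
    rw [inner_sub_left, inner_smul_eq hP, inv_smul_eq_iff.2 h.symm, sub_self]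

lemma inner_eq_zero_of_fixed
    (hP : ∀ (i : ι) (x y : E), ⟪P.reflection i x, P.reflection i y⟫ = ⟪x, y⟫)
    {g : P.weylGroup} {x y : E} (hx : g • x = x) (hy : y ∈ mov g) : ⟪x, y⟫ = 0 := by
  rw [real_inner_comm]
  exact Submodule.mem_orthogonal _ _ |>.1 ((mem_mov_orthogonal hP).2 hx) y hy

lemma root_mem_mov (i : ι) : P.root i ∈ mov (ofIdx P i) := by
  rw [mov_ofIdx]; exact Submodule.mem_span_singleton_self _

lemma sub_ofIdx_mul_smul {h : P.weylGroup} {x : E} (hx : h • x = x) (i : ι) :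
    x - (ofIdx P i * h) • x = P.toLinearMap x (P.coroot i) • P.root i := by
  rw [mul_smul, hx, ofIdx_smul_eq, sub_sub_cancel]

/-- If `r_i h` moves `k` by the root of `r_i`, and that root is not moved by `h`, then `h` fixes `k`
and `k` pairs to `1` with the coroot. -/
lemma fixed_of_sub_ofIdx_mul_smul {h : P.weylGroup} {k : E} {i : ι}
    (hk : k - (ofIdx P i * h) • k = P.root i) (hi : P.root i ∉ mov h) :
    h • k = k ∧ P.toLinearMap k (P.coroot i) = 1 := by
  have h1 : h • k = ofIdx P i • (k - P.root i) := by
    rw [sub_eq_iff_eq_add, ← sub_eq_iff_eq_add'] at hk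
    rw [hk, mul_smul, smul_smul, ofIdx_mul_self, one_smul]
  rw [ofIdx_smul_eq, map_sub, LinearMap.sub_apply, P.root_coroot_two] at h1
  have h2 : k - h • k = (P.toLinearMap k (P.coroot i) - 1) • P.root i := by
    rw [h1]; module
  have h3 : P.toLinearMap k (P.coroot i) - 1 = 0 := by
    by_contra hne
    refine hi ?_
    have := Submodule.smul_mem _ (P.toLinearMap k (P.coroot i) - 1)⁻¹ (sub_smul_mem_mov h k)
    rwa [h2, smul_smul, inv_mul_cancel₀ hne, one_smul] at this
  rw [h3, zero_smul, sub_eq_zero] at h2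
  exact ⟨h2.symm, by linarith⟩

/-- The Euler form of `u⁻¹ v`, at the roots `i` and `j`, is nonnegative: `⟪k, root j⟫ ≥ 0` for some
(equivalently, if `root j` lies in the moved space of `u⁻¹ v`, for every) solution `k` of
`(id - u⁻¹ v) k = root i`. -/
def EulerNonneg (u v : P.weylGroup) (i j : ι) : Prop :=
  ∃ k : E, k - (u⁻¹ * v) • k = P.root i ∧ 0 ≤ ⟪k, P.root j⟫

variable {b : P.Base} {u v : P.weylGroup} {i j : ι}

/-- The positive roots `i` and `j` describe an atom `u r_i` and a coatom `v r_j` of the toric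
interval `[u, v]`. -/
structure IsAtomCoatom (b : P.Base) (u v : P.weylGroup) (i j : ι) : Prop where
  toric : IsToric b u v
  pos_left : b.IsPos i
  pos_right : b.IsPos j
  step_left : BruhatStep b u (u * ofIdx P i)
  le_left : BruhatLE b (u * ofIdx P i) v
  step_right : BruhatStep b (v * ofIdx P j) v
  le_right : BruhatLE b u (v * ofIdx P j)

lemma EulerNonneg.of_inv (hP : ∀ (i : ι) (x y : E), ⟪P.reflection i x, P.reflection i y⟫ = ⟪x, y⟫)
    (h : EulerNonneg u⁻¹ v⁻¹ (u • i) (P.reflectionPerm (v • j) (v • j))) :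
    EulerNonneg u v i j := by
  obtain ⟨k, hk, hk'⟩ := h
  refine ⟨-(v⁻¹ • k), ?_, ?_⟩
  · have h1 : P.root i = u⁻¹ • P.root (u • i) := by rw [root_smul_idx, inv_smul_smul]
    rw [h1, ← hk, smul_sub, smul_neg, mul_smul, smul_inv_smul, inv_inv, mul_smul, inv_smul_smul]
    abel
  · rw [root_reflectionPerm_self, inner_neg_right, root_smul_idx] at hk'
    rwa [inner_neg_left, inner_smul_eq hP, inv_inv]

lemma exists_fixed_coroot_eq_one [FiniteDimensional ℝ E]
    (hP : ∀ (i : ι) (x y : E), ⟪P.reflection i x, P.reflection i y⟫ = ⟪x, y⟫)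
    {h : P.weylGroup} (hi : P.root i ∉ mov h) :
    ∃ x : E, h • x = x ∧ P.toLinearMap x (P.coroot i) = 1 := by
  rw [← Submodule.orthogonal_orthogonal (mov h), Submodule.mem_orthogonal] at hi
  push Not at hi
  obtain ⟨y, hy, hne⟩ := hi
  have h1 := coroot_mul_inner hP i y
  have h2 : P.toLinearMap y (P.coroot i) ≠ 0 := by
    intro h0
    rw [h0, zero_mul] at h1
    exact hne (by linarith)
  refine ⟨(P.toLinearMap y (P.coroot i))⁻¹ • y, ?_, ?_⟩
  · rw [smul_comm, (mem_mov_orthogonal hP).1 hy]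
  · rw [map_smul, LinearMap.smul_apply, smul_eq_mul, inv_mul_cancel₀ h2]

variable [Finite ι] [P.IsCrystallographic] [P.IsReduced]

lemma IsToric.inv (h : IsToric b u v) : IsToric b u⁻¹ v⁻¹ := by
  refine ⟨h.1.inv, ?_⟩
  rw [length_inv, length_inv]
  have e : u⁻¹⁻¹ * v⁻¹ = (v * u⁻¹)⁻¹ := by group
  have e2 : mov ((v * u⁻¹)⁻¹) = mov (v * u⁻¹) := by
    have key : ∀ g : P.weylGroup, mov g⁻¹ ≤ mov g := by
      rintro g - ⟨y, rfl⟩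
      change y - g⁻¹ • y ∈ _
      have := smul_sub_mem_mov g (g⁻¹ • y)
      rwa [smul_inv_smul] at this
    refine le_antisymm (key _) ?_
    simpa using key (v * u⁻¹)⁻¹
  rw [e, e2, show v * u⁻¹ = u * (u⁻¹ * v) * u⁻¹ by group, finrank_mov_conj]
  exact h.2

lemma IsAtomCoatom.inv (h : IsAtomCoatom b u v i j) :
    IsAtomCoatom b u⁻¹ v⁻¹ (u • i) (P.reflectionPerm (v • j) (v • j)) := by
  have e1 : u⁻¹ * ofIdx P (u • i) = (u * ofIdx P i)⁻¹ := by
    rw [← conj_ofIdx, mul_inv_rev, ofIdx_inv]; group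
  have e2 : v⁻¹ * ofIdx P (P.reflectionPerm (v • j) (v • j)) = (v * ofIdx P j)⁻¹ := by
    rw [ofIdx_reflectionPerm_self, ← conj_ofIdx, mul_inv_rev, ofIdx_inv]; group
  refine ⟨h.toric.inv, (length_lt_mul_ofIdx_iff h.pos_left).1 h.step_left.length_lt,
    (isPos_reflectionPerm_self b _).2
      ((length_mul_ofIdx_lt_iff h.pos_right).1 h.step_right.length_lt), ?_, ?_, ?_, ?_⟩
  · rw [e1]; exact h.step_left.inv
  · rw [e1]; exact h.le_left.inv
  · rw [e2]; exact h.step_right.inv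
  · rw [e2]; exact h.le_right.inv

end Isometry

section Euler

variable {ι E N : Type*} [NormedAddCommGroup E] [InnerProductSpace ℝ E]
  [AddCommGroup N] [Module ℝ N] {P : RootPairing ι ℝ E N} {b : P.Base} {u v : P.weylGroup}
  {i j : ι}

lemma EulerNonneg.congr {u' v' : P.weylGroup} (h : EulerNonneg u v i j)
    (e : u'⁻¹ * v' = u⁻¹ * v) : EulerNonneg u' v' i j := by
  unfold EulerNonneg
  rwa [e]

lemma EulerNonneg.of_combination {c d : ι} {A B : ℝ} (hA : 0 ≤ A) (hB : 0 ≤ B)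
    (h : P.root i = A • P.root c + B • P.root d) (hc : EulerNonneg u v c j)
    (hd : EulerNonneg u v d j) : EulerNonneg u v i j := by
  obtain ⟨k, hk, hk'⟩ := hc
  obtain ⟨l, hl, hl'⟩ := hd
  refine ⟨A • k + B • l, ?_, ?_⟩
  · rw [h, ← hk, ← hl, smul_add, smul_comm _ A, smul_comm _ B, smul_sub, smul_sub]
    abel
  · rw [inner_add_left, real_inner_smul_left, real_inner_smul_left]
    positivity

lemma inv_mul_eq_ofIdx_mul (u v : P.weylGroup) (i : ι) :
    u⁻¹ * v = ofIdx P i * ((u * ofIdx P i)⁻¹ * v) := by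
  rw [mul_inv_rev, ofIdx_inv, mul_assoc, ofIdx_mul_cancel_left]

lemma IsToric.simple_mul [Finite ι] [P.IsCrystallographic] [P.IsReduced] {p : ι}
    (hp : p ∈ b.support) (ht : IsToric b u v)
    (hv : length b (ofIdx P p * v) < length b v) (hu : length b (ofIdx P p * u) < length b u) :
    IsToric b (ofIdx P p * u) (ofIdx P p * v) := by
  refine ⟨ht.le.simple_mul_le_simple_mul hp hu, ?_⟩
  have h1 := length_simple_mul_of_lt hp hv
  have h2 := length_simple_mul_of_lt hp hu
  have h3 := ht.2
  rw [show (ofIdx P p * u)⁻¹ * (ofIdx P p * v) = u⁻¹ * v by group]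
  omega

variable [FiniteDimensional ℝ E]

lemma IsToric.root_notMem_mov (h : IsToric b u v)
    (h1 : BruhatLE b u (u * ofIdx P i)) (h2 : BruhatLE b (u * ofIdx P i) v) :
    P.root i ∉ mov ((u * ofIdx P i)⁻¹ * v) := by
  have h3 := (h.mov_right h1 h2).2
  rw [inv_mul_cancel_left] at h3
  exact fun h4 => P.ne_zero i (Submodule.disjoint_def.1 h3 _ (root_mem_mov i) h4)

variable [Finite ι] [P.IsCrystallographic] [P.IsReduced]

/-- In a toric diamond `u' < u, q < a` with `u = r_p u'` for a simple root `p`, the label `i` of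
`u < a` is a nonnegative combination of the labels `d` of `u' < q` and `c` of `u' < u`.

The coefficient `A` of `d` is positive because `u'` sends `c` to `p` and the other two labels to
positive roots different from `p`. The sign of the coefficient `B` of `c` is read off from the Euler
form of `u'⁻¹ a` at `d'`, which is known to be nonnegative at `c` and vanishes at `d`: it is also
nonnegative at `i`, as `d'` is the difference of a nonnegative multiple of `i` and a multiple of
`a⁻¹ p`, at which the functional of `i` vanishes. -/
lemma exists_nonneg_combination
    (hP : ∀ (i : ι) (x y : E), ⟪P.reflection i x, P.reflection i y⟫ = ⟪x, y⟫)
    {p c d d' : ι} (hp : p ∈ b.support) {u' a q : P.weylGroup}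
    (hpu : ofIdx P p * u = u') (hu : BruhatStep b u' u) (ha : BruhatStep b u a)
    (ht : IsToric b u' a)
    (hq : BruhatStep b u' q) (hqa : BruhatStep b q a) (hqu : q ≠ u)
    (hc : b.IsPos c) (hd : b.IsPos d) (hd' : b.IsPos d') (hi : b.IsPos i)
    (ec : u = u' * ofIdx P c) (ei : a = u * ofIdx P i) (ed : q = u' * ofIdx P d)
    (ed' : a = q * ofIdx P d') (hE : EulerNonneg u' a c d') :
    ∃ A B : ℝ, 0 ≤ A ∧ 0 ≤ B ∧ P.root i = A • P.root d + B • P.root c := by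
  obtain ⟨f, hfp, hf⟩ := exists_height_away (b := b) p hp
  have hf' : ∀ l, b.IsPos l → 0 ≤ f (P.root l) := by
    intro l hl
    by_cases h : l = p
    · rw [h, hfp]
    · exact (hf l hl h).le
  have hdc : d ≠ c := by rintro rfl; exact hqu (by rw [ed, ec])
  have hd'i : d' ≠ i := by
    rintro rfl
    exact hqu (mul_right_cancel (ed'.symm.trans ei))
  have epu : u = ofIdx P p * u' := by rw [← hpu, ofIdx_mul_cancel_left]
  -- the simple root `p` is the left root of `u' < u`
  have hcp : u' • c = p := by
    have h1 : b.IsPos (u' • c) := (length_lt_mul_ofIdx_iff hc).1 (ec ▸ hu.length_lt)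
    refine eq_of_ofIdx_eq h1 (b.isPos_of_mem_support hp) ?_
    rw [mul_ofIdx] at ec
    exact mul_right_cancel (ec.symm.trans epu)
  have hui : b.IsPos (u • i) := (length_lt_mul_ofIdx_iff hi).1 (ei ▸ ha.length_lt)
  have huip : u • i ≠ p := by
    intro h
    rw [mul_ofIdx, h, hpu] at ei
    have h1 := ha.length_lt
    have h2 := hu.length_lt
    rw [ei] at h1
    omega
  have hu'i : 0 < f (u' • P.root i) := by
    rw [← root_smul_idx]
    have e : u' • i = ofIdx P p • (u • i) := by rw [← hpu, mul_smul]
    rw [e]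
    refine hf _ (isPos_simple_smul hp hui huip) ?_
    intro h
    have h1 : u • i = P.reflectionPerm p p := by
      rw [← ofIdx_smul_idx]; nth_rw 2 [← h]; rw [← mul_smul, ofIdx_mul_self, one_smul]
    rw [h1, isPos_reflectionPerm_self] at hui
    exact hui (b.isPos_of_mem_support hp)
  have hu'd : 0 < f (u' • P.root d) := by
    rw [← root_smul_idx]
    refine hf _ ((length_lt_mul_ofIdx_iff hd).1 (ed ▸ hq.length_lt)) ?_
    rw [← hcp]
    exact fun h => hdc (MulAction.injective u' h)
  have hfc : f (u' • P.root c) = 0 := by rw [← root_smul_idx, hcp, hfp]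
  -- the moved space of `u'⁻¹ a` is spanned by the roots `c` and `i`, and contains `d` and `d'`
  have hm1 := ht.mov_right hu.le ha.le
  have hm2 := ht.mov_right hq.le hqa.le
  have e1 : u'⁻¹ * u = ofIdx P c := by rw [ec, inv_mul_cancel_left]
  have e2 : u⁻¹ * a = ofIdx P i := by rw [ei, inv_mul_cancel_left]
  have e3 : u'⁻¹ * q = ofIdx P d := by rw [ed, inv_mul_cancel_left]
  have e4 : q⁻¹ * a = ofIdx P d' := by rw [ed', inv_mul_cancel_left]
  rw [e1, e2] at hm1
  rw [e3, e4] at hm2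
  have hspan : ∀ x ∈ mov (u'⁻¹ * a), ∃ s t : ℝ, x = s • P.root c + t • P.root i := by
    intro x hx
    rw [hm1.1, mov_ofIdx, mov_ofIdx, Submodule.mem_sup] at hx
    obtain ⟨y, hy, z, hz, rfl⟩ := hx
    obtain ⟨s, rfl⟩ := Submodule.mem_span_singleton.1 hy
    obtain ⟨t, rfl⟩ := Submodule.mem_span_singleton.1 hz
    exact ⟨s, t, rfl⟩
  have hdm : P.root d ∈ mov (u'⁻¹ * a) := hm2.1 ▸ Submodule.mem_sup_left (root_mem_mov d)
  have hd'm : P.root d' ∈ mov (u'⁻¹ * a) := hm2.1 ▸ Submodule.mem_sup_right (root_mem_mov d')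
  have him : P.root i ∈ mov (u'⁻¹ * a) := hm1.1 ▸ Submodule.mem_sup_right (root_mem_mov i)
  obtain ⟨s, t, hst⟩ := hspan _ hdm
  have ht0 : t ≠ 0 := by
    rintro rfl
    rw [zero_smul, add_zero] at hst
    have h3 := LinearIndependent.pair_iff.1 (linearIndependent_of_isPos hd hc hdc) 1 (-s) (by
      rw [hst]; module)
    norm_num at h3
  have hiAB : P.root i = t⁻¹ • P.root d + (-(t⁻¹ * s)) • P.root c := by
    rw [hst, smul_add, smul_smul, smul_smul, inv_mul_cancel₀ ht0]; module
  set A := t⁻¹ with hA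
  set B := -(A * s) with hB
  have hApos : 0 < A := by
    have h1 := hu'i
    rw [hiAB, smul_add, smul_comm u' A, smul_comm u' B, map_add, map_smul f A, map_smul f B, hfc,
      smul_zero, add_zero, smul_eq_mul] at h1
    exact pos_of_mul_pos_left h1 hu'd.le
  refine ⟨A, B, hApos.le, ?_, hiAB⟩
  -- the root `c` in terms of `i` and `a⁻¹ p`
  have hψ : a⁻¹ • P.root p = P.toLinearMap (P.root c) (P.coroot i) • P.root i - P.root c := by
    have h1 : a⁻¹ = ofIdx P i * ofIdx P c * u'⁻¹ := by
      rw [ei, ec, mul_inv_rev, mul_inv_rev, ofIdx_inv, ofIdx_inv, mul_assoc]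
    rw [h1, ← hcp, root_smul_idx, mul_smul, inv_smul_smul, mul_smul]
    have h2 : ofIdx P c • P.root c = -P.root c := reflection_apply_self P c
    rw [h2, smul_neg, ofIdx_smul_eq]
    abel
  set τ := P.toLinearMap (P.root c) (P.coroot i) with hτ
  have hcψ : P.root c = τ • P.root i - a⁻¹ • P.root p := by rw [hψ]; abel
  obtain ⟨x, y, hxy⟩ := hspan _ hd'm
  have hY : 0 ≤ y + x * τ := by
    have h1 : P.root d' = (y + x * τ) • P.root i - x • (a⁻¹ • P.root p) := by
      rw [hxy]
      nth_rw 1 [hcψ]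
      rw [smul_sub, add_smul, mul_smul]
      abel
    have h2 : a • P.root i = -(u • P.root i) := by
      have : ofIdx P i • P.root i = -P.root i := reflection_apply_self P i
      rw [ei, mul_smul, this, smul_neg]
    have h3 : -(a • P.root d') = (y + x * τ) • P.root (u • i) + x • P.root p := by
      rw [h1, smul_sub, smul_comm a (y + x * τ), smul_comm a x, h2, smul_inv_smul, root_smul_idx,
        smul_neg]
      abel
    have h4 : 0 ≤ f (-(a • P.root d')) := by
      rw [← root_smul_idx, ← root_reflectionPerm_self]
      refine hf' _ ((isPos_reflectionPerm_self b _).2 ?_)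
      have h5 := hqa.length_lt
      rw [show q = a * ofIdx P d' by rw [ed', mul_ofIdx_cancel_right]] at h5
      exact (length_mul_ofIdx_lt_iff hd').1 h5
    rw [h3, map_add, map_smul f (y + x * τ), map_smul f x, hfp, smul_zero, add_zero,
      smul_eq_mul] at h4
    exact nonneg_of_mul_nonneg_left h4 (hf _ hui huip)
  -- the solutions of `(id - u'⁻¹ a) k = root`, one for each of the roots `c`, `i` and `d`
  obtain ⟨k, hk, hk'⟩ := hE
  obtain ⟨ki, hki⟩ := mem_mov.1 him
  obtain ⟨kd, hkd⟩ := mem_mov.1 hdm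
  have g1 : u'⁻¹ * a = ofIdx P c * ofIdx P i := by rw [← e1, ← e2]; group
  have g2 : u'⁻¹ * a = ofIdx P d * ofIdx P d' := by rw [← e3, ← e4]; group
  have g3 : u'⁻¹ * a = ofIdx P i * ofIdx P (a⁻¹ • p) := by
    have h1 : a * ofIdx P (a⁻¹ • p) = ofIdx P p * a := by rw [mul_ofIdx, smul_inv_smul]
    have h2 : u' * ofIdx P i = ofIdx P p * a := by
      rw [← hpu, ei, mul_assoc]
    rw [eq_comm, eq_inv_mul_iff_mul_eq, ← mul_assoc, h2, ← h1, mul_ofIdx_cancel_right]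
  have k1 := fixed_of_sub_ofIdx_mul_smul (h := ofIdx P i) (by rw [← g1]; exact hk)
    (fun h => P.ne_zero c (Submodule.disjoint_def.1 hm1.2 _ (root_mem_mov c) h))
  have k2 := fixed_of_sub_ofIdx_mul_smul (h := ofIdx P d') (by rw [← g2]; exact hkd)
    (fun h => P.ne_zero d (Submodule.disjoint_def.1 hm2.2 _ (root_mem_mov d) h))
  have k3 := fixed_of_sub_ofIdx_mul_smul (h := ofIdx P (a⁻¹ • p)) (by rw [← g3]; exact hki) (by
    rw [mov_ofIdx, Submodule.mem_span_singleton]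
    rintro ⟨r, hr⟩
    rw [root_smul_idx, hψ] at hr
    have hr0 : r ≠ 0 := by
      rintro rfl
      rw [zero_smul] at hr
      exact P.ne_zero i hr.symm
    have h1 : P.root c = (τ - r⁻¹) • P.root i := by
      have : r⁻¹ • P.root i = τ • P.root i - P.root c := by rw [inv_smul_eq_iff₀ hr0, hr]
      rw [sub_smul, this]
      abel
    have h2 : P.root c ∈ mov (ofIdx P i) := by
      rw [h1]; exact Submodule.smul_mem _ _ (root_mem_mov i)
    exact P.ne_zero c (Submodule.disjoint_def.1 hm1.2 _ (root_mem_mov c) h2))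
  have hpos : ∀ (l : ι) (z : E), P.toLinearMap z (P.coroot l) = 1 → 0 < ⟪z, P.root l⟫ := by
    intro l z hz
    have h1 := coroot_mul_inner hP l z
    have h2 := inner_root_self_pos (P := P) l
    rw [hz] at h1
    linarith
  have hkiψ : ⟪ki, a⁻¹ • P.root p⟫ = 0 := by
    rw [← root_smul_idx]
    exact inner_eq_zero_of_fixed hP k3.1 (root_mem_mov _)
  have hki' : ⟪ki, P.root d'⟫ = B * ⟪k, P.root d'⟫ := by
    have h1 : (u'⁻¹ * a) • (ki - A • kd - B • k) = ki - A • kd - B • k := by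
      have h2 : ki - (u'⁻¹ * a) • ki =
          A • (kd - (u'⁻¹ * a) • kd) + B • (k - (u'⁻¹ * a) • k) := by
        rw [hki, hkd, hk, hiAB]
      rw [smul_sub, smul_sub, smul_comm _ A, smul_comm _ B]
      generalize (u'⁻¹ * a) • ki = z1 at *
      generalize (u'⁻¹ * a) • kd = z2 at *
      generalize (u'⁻¹ * a) • k = z3 at *
      linear_combination (norm := module) -h2
    have h3 := inner_eq_zero_of_fixed hP h1 hd'm
    rw [inner_sub_left, inner_sub_left, real_inner_smul_left, real_inner_smul_left,
      inner_eq_zero_of_fixed hP k2.1 (root_mem_mov _)] at h3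
    linarith
  have hkid : 0 ≤ ⟪ki, P.root d'⟫ := by
    have h1 : P.root d' = (y + x * τ) • P.root i - x • (a⁻¹ • P.root p) := by
      rw [hψ, hxy]; module
    rw [h1, inner_sub_right, real_inner_smul_right, real_inner_smul_right, hkiψ]
    have := mul_nonneg hY (hpos i ki k3.2).le
    linarith
  by_contra hBneg
  push Not at hBneg
  have h0 : ⟪k, P.root d'⟫ = 0 := by nlinarith
  rw [hxy, inner_add_right, real_inner_smul_right, real_inner_smul_right,
    inner_eq_zero_of_fixed hP k1.1 (root_mem_mov i), mul_zero, add_zero] at h0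
  have hx0 : x = 0 := (mul_eq_zero.1 h0).resolve_right (hpos c k k1.2).ne'
  rw [hx0, zero_smul, zero_add] at hxy
  have h3 := LinearIndependent.pair_iff.1 (linearIndependent_of_isPos hd' hi hd'i) 1 (-y) (by
    rw [hxy]; module)
  norm_num at h3

/-- The induction step for `IsAtomCoatom.eulerNonneg`: multiplication with a simple reflection `p`
that is a left descent of both `v` and the coatom `v r_j`.

If `p` is also a left descent of `u`, then `[p u, p v]` has the same Euler form. Either `p a` is an
atom of it, with the same label as `a`, or `a` lies in `[p u, p v]`, and its label is a nonnegative
combination of labels of atoms by `exists_nonneg_combination`. If `p` is not a left descent of `u`,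
the interval is shortened to `[p u, v]`. -/
lemma IsAtomCoatom.eulerNonneg_step
    (hP : ∀ (i : ι) (x y : E), ⟪P.reflection i x, P.reflection i y⟫ = ⟪x, y⟫)
    (h : IsAtomCoatom b u v i j) {p : ι} (hp : p ∈ b.support)
    (hv : length b (ofIdx P p * v) < length b v)
    (hx : length b (ofIdx P p * (v * ofIdx P j)) < length b (v * ofIdx P j))
    (IH : ∀ (u' v' : P.weylGroup) (i' j' : ι), 2 * length b v' + length b u <
      2 * length b v + length b u' → IsAtomCoatom b u' v' i' j' → EulerNonneg u' v' i' j') :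
    EulerNonneg u v i j := by
  have ht := h.toric
  have hv' := length_simple_mul_of_lt hp hv
  have hla := ht.length_step (BruhatLE.refl b u) h.step_left h.le_left
  have hlx := ht.length_step h.le_right h.step_right (BruhatLE.refl b v)
  have hux := h.le_right.length_le
  have hxne : v * ofIdx P j ≠ ofIdx P p * v := by
    intro e
    rw [e, ofIdx_mul_cancel_left] at hx
    omega
  by_cases hu : length b (ofIdx P p * u) < length b u
  · have hu' := length_simple_mul_of_lt hp hu
    have ht' := ht.simple_mul hp hv hu
    have hxs := h.step_right.simple_mul hp hxne
    have hux' := h.le_right.simple_mul_le_simple_mul hp hu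
    rw [← mul_assoc] at hxs hux'
    have e : u⁻¹ * v = (ofIdx P p * u)⁻¹ * (ofIdx P p * v) := by group
    by_cases ha : length b (ofIdx P p * (u * ofIdx P i)) < length b (u * ofIdx P i)
    · have has := h.step_left.simple_mul hp (by
        intro e'
        rw [e', ofIdx_mul_cancel_left, ← e'] at hu
        exact absurd h.step_left.length_lt (by omega))
      have hav := h.le_left.simple_mul_le_simple_mul hp ha
      rw [← mul_assoc] at has hav
      exact (IH _ _ i j (by omega) ⟨ht', h.pos_left, h.pos_right, has, hav, hxs, hux'⟩).congr e
    · have ha' := length_simple_mul_of_not_lt hp ha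
      have hav : BruhatLE b (u * ofIdx P i) (ofIdx P p * v) :=
        h.le_left.le_simple_mul hp (by omega)
      have hus : BruhatStep b (ofIdx P p * u) u := bruhatStep_ofIdx_mul hu
      obtain ⟨q, hqu, hq1, hq2⟩ := exists_ne_middle hus h.step_left (by omega)
      obtain ⟨c, hc, ec, -⟩ := hus.exists_right_root
      obtain ⟨d, hd, ed, -⟩ := hq1.exists_right_root
      obtain ⟨d', hd', ed', ed''⟩ := hq2.exists_right_root
      have hla' := hav.length_le
      have hta : IsToric b (ofIdx P p * u) (u * ofIdx P i) :=
        ht'.left (hus.le.trans h.step_left.le) hav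
      have hEc : EulerNonneg (ofIdx P p * u) (u * ofIdx P i) c d' :=
        IH _ _ c d' (by omega) ⟨hta, hc, hd', ec ▸ hus, ec ▸ h.step_left.le, ed'' ▸ hq2,
          ed'' ▸ hq1.le⟩
      obtain ⟨A, B, hA, hB, hAB⟩ := exists_nonneg_combination hP hp rfl hus h.step_left
        hta hq1 hq2 hqu hc hd hd' h.pos_left ec rfl ed ed' hEc
      refine (EulerNonneg.of_combination hA hB hAB ?_ ?_).congr e
      · exact IH _ _ d j (by omega) ⟨ht', hd, h.pos_right, ed ▸ hq1,
          ed ▸ hq2.le.trans hav, hxs, hux'⟩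
      · exact IH _ _ c j (by omega) ⟨ht', hc, h.pos_right, ec ▸ hus,
          ec ▸ h.step_left.le.trans hav, hxs, hux'⟩
  · have hu' := length_simple_mul_of_not_lt hp hu
    have hus : BruhatStep b u (ofIdx P p * u) := bruhatStep_of_lt_ofIdx_mul (by omega)
    have huv : BruhatLE b (ofIdx P p * u) v := ht.le.simple_mul_le hp hv
    have hux' : BruhatLE b (ofIdx P p * u) (v * ofIdx P j) := h.le_right.simple_mul_le hp hx
    have ht' := ht.right hus.le huv
    obtain ⟨c, hc, ec, ec'⟩ := hus.exists_right_root
    obtain ⟨y, hy, hyc⟩ := exists_fixed_coroot_eq_one (h := (ofIdx P p * u)⁻¹ * v) (i := c) hP (by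
      rw [ec]
      exact ht.root_notMem_mov (ec ▸ hus.le) (ec ▸ huv))
    have hjm : P.root j ∈ mov ((ofIdx P p * u)⁻¹ * v) := by
      rw [(ht'.mov_right hux' h.step_right.le).1]
      refine Submodule.mem_sup_right ?_
      rw [show (v * ofIdx P j)⁻¹ * v = ofIdx P j by rw [mul_inv_rev, ofIdx_inv]; group]
      exact root_mem_mov j
    have hyj := inner_eq_zero_of_fixed hP hy hjm
    have euv : u⁻¹ * v = ofIdx P c * ((ofIdx P p * u)⁻¹ * v) := by
      rw [ec]; exact inv_mul_eq_ofIdx_mul u v c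
    by_cases hic : i = c
    · subst hic
      refine ⟨y, ?_, hyj.ge⟩
      rw [euv, sub_ofIdx_mul_smul hy, hyc, one_smul]
    · have hau : u ≠ ofIdx P p * (u * ofIdx P i) := by
        intro e
        refine hic (eq_of_ofIdx_eq h.pos_left hc (mul_left_cancel (a := u) ?_))
        rw [← ec]
        nth_rw 2 [e]
        rw [ofIdx_mul_cancel_left]
      have has := h.step_left.simple_mul hp hau
      have hav := h.le_left.simple_mul_le hp hv
      rw [← mul_assoc] at has hav
      obtain ⟨k, hk, hkj⟩ := IH _ _ i j (by omega)
        ⟨ht', h.pos_left, h.pos_right, has, hav, h.step_right, hux'⟩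
      -- shift `k` by a vector fixed by `(p u)⁻¹ v` to solve the equation for `r_c (p u)⁻¹ v`
      refine ⟨k + (P.toLinearMap (P.root i) (P.coroot c) - P.toLinearMap k (P.coroot c)) • y,
        ?_, ?_⟩
      · set μ := P.toLinearMap (P.root i) (P.coroot c) - P.toLinearMap k (P.coroot c) with hμ
        have h1 : ((ofIdx P p * u)⁻¹ * v) • k = k - P.root i := by rw [← hk]; abel
        rw [euv, mul_smul, smul_add, smul_comm _ μ, hy, h1, ofIdx_smul_eq]
        simp only [map_add, map_sub, map_smul, LinearMap.add_apply, LinearMap.sub_apply,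
          LinearMap.smul_apply, hyc, smul_eq_mul, hμ]
        module
      · rw [inner_add_left, real_inner_smul_left, hyj, mul_zero, add_zero]
        exact hkj

/-- The Euler form of a toric interval is nonnegative on atoms against coatoms.

A left descent of `v` is a left descent of the coatom `v r_j` as well, unless `v r_j` arises from
`v` by removing this descent. In the latter case the inverse interval `[u⁻¹, v⁻¹]` is used: every left
descent of the inverse of `v r_j` is then a left descent of `v⁻¹`. -/
theorem IsAtomCoatom.eulerNonneg
    (hP : ∀ (i : ι) (x y : E), ⟪P.reflection i x, P.reflection i y⟫ = ⟪x, y⟫)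
    (h : IsAtomCoatom b u v i j) : EulerNonneg u v i j := by
  induction hn : 2 * length b v - length b u using Nat.strong_induction_on
    generalizing u v i j with
  | _ n ih =>
  subst hn
  have huv := h.toric.le.length_le
  have IH : ∀ (u' v' : P.weylGroup) (i' j' : ι), 2 * length b v' + length b u <
      2 * length b v + length b u' → IsAtomCoatom b u' v' i' j' → EulerNonneg u' v' i' j' := by
    intro u' v' i' j' hl h'
    have := h'.toric.le.length_le
    exact ih _ (by omega) h' rfl
  have hla := h.toric.length_step (BruhatLE.refl b u) h.step_left h.le_left
  have hlx := h.toric.length_step h.le_right h.step_right (BruhatLE.refl b v)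
  have hv1 : v ≠ 1 := by
    rintro rfl
    rw [length_one] at hlx
    omega
  obtain ⟨s, hs, hsv⟩ := exists_left_descent (b := b) hv1
  by_cases hx : length b (ofIdx P s * (v * ofIdx P j)) < length b (v * ofIdx P j)
  · exact h.eulerNonneg_step hP hs hsv hx IH
  have hx' := length_simple_mul_of_not_lt hs hx
  have hxs : v * ofIdx P j = ofIdx P s * v := by
    by_contra hne
    have := (h.step_right.simple_mul hs hne).length_lt
    omega
  by_cases hx1 : v * ofIdx P j = 1
  · have hvj : v = ofIdx P j := by rw [mul_eq_one_iff_eq_inv, ofIdx_inv] at hx1; exact hx1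
    have hu1 : u = 1 := by
      refine eq_one_of_length_eq_zero (b := b) ?_
      have := h.le_right.length_le
      rw [hx1, length_one] at this
      omega
    have hav := h.le_left.eq_of_length_le (by
      rw [hx1, length_one] at hlx
      omega)
    rw [hu1, one_mul, hvj] at hav
    have hij := eq_of_ofIdx_eq h.pos_left h.pos_right hav
    refine ⟨(1 / 2 : ℝ) • P.root i, ?_, ?_⟩
    · rw [hu1, hvj, inv_one, one_mul, ← hij, ofIdx_smul_eq, map_smul, LinearMap.smul_apply,
        P.root_coroot_two]
      simp
    · rw [← hij, real_inner_smul_left]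
      have := inner_root_self_pos (P := P) i
      positivity
  · obtain ⟨p, hp, hpx⟩ := exists_left_descent (b := b) (inv_ne_one.2 hx1)
    refine EulerNonneg.of_inv hP (h.inv.eulerNonneg_step hP hp ?_ ?_ ?_)
    · have e : v⁻¹ = (v * ofIdx P j)⁻¹ * ofIdx P s := by
        rw [hxs, mul_inv_rev, ofIdx_inv, mul_ofIdx_cancel_right]
      have h1 := length_mul_le (b := b) (ofIdx P p * (v * ofIdx P j)⁻¹) (ofIdx P s)
      have h2 := length_simple_le (P := P) hs
      have h3 := length_simple_mul_of_lt hp hpx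
      rw [length_inv] at h3
      rw [length_inv, e, ← mul_assoc]
      omega
    · have e : v⁻¹ * ofIdx P (P.reflectionPerm (v • j) (v • j)) = (v * ofIdx P j)⁻¹ := by
        rw [ofIdx_reflectionPerm_self, ← conj_ofIdx, mul_inv_rev, ofIdx_inv]; group
      rwa [e]
    · intro u' v' i' j' hl h'
      rw [length_inv, length_inv] at hl
      exact IH u' v' i' j' hl h'

end Euler

/-! ### Polytopes of toric posets -/

section Toric

variable {X E : Type*} [PartialOrder X] [NormedAddCommGroup E] [InnerProductSpace ℝ E]

/-- The combinatorial data from which the facets of the polytopes spanned by the intervals of a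
finite poset can be determined: a point `φ x` for every element `x` and a subspace `D u v`
(the direction of the affine span of the polytope of `[u, v]`) for every interval, such that
directions add up independently along chains, intervals of length two have at least two middle
elements, and the hyperplane of `[a, v]`, for an atom `a` of `[u, v]`, has all coatoms of `[u, v]`
on the side of `v` that contains `u`; and dually. -/
structure IsToricPoset (φ : X → E) (D : X → X → Submodule ℝ E) : Prop where
  sup : ∀ {u x v : X}, u ≤ x → x ≤ v → D u v = D u x ⊔ D x v
  disjoint : ∀ {u x v : X}, u ≤ x → x ≤ v → Disjoint (D u x) (D x v)
  sub_mem : ∀ {u v : X}, u ≤ v → φ v - φ u ∈ D u v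
  covBy : ∀ {u v : X}, u ⋖ v → D u v = Submodule.span ℝ {φ v - φ u}
  ne_of_covBy : ∀ {u v : X}, u ⋖ v → φ u ≠ φ v
  diamond : ∀ {u m v : X}, u ⋖ m → m ⋖ v → ∃ m', m' ≠ m ∧ u ⋖ m' ∧ m' ⋖ v
  atoms_indep : ∀ {u a a' : X}, u ⋖ a → u ⋖ a' → a ≠ a' → φ a' - φ u ∉ D u a
  coatoms_indep : ∀ {v b b' : X}, b ⋖ v → b' ⋖ v → b ≠ b' → φ b' - φ v ∉ D b v
  facet_atom : ∀ {u v a b : X}, u ⋖ a → a ≤ v → u ≤ b → b ⋖ v → ∀ h ∈ (D a v)ᗮ,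
    ⟪h, φ u⟫ ≤ ⟪h, φ a⟫ → ⟪h, φ b⟫ ≤ ⟪h, φ v⟫
  facet_coatom : ∀ {u v a b : X}, u ⋖ a → a ≤ v → u ≤ b → b ⋖ v → ∀ h ∈ (D u b)ᗮ,
    ⟪h, φ v⟫ ≤ ⟪h, φ b⟫ → ⟪h, φ a⟫ ≤ ⟪h, φ u⟫

namespace IsToricPoset

variable {φ : X → E} {D : X → X → Submodule ℝ E} {u v a b x y : X}

open OrderDual

lemma dual (H : IsToricPoset φ D) :
    IsToricPoset (X := Xᵒᵈ) (fun x => φ (ofDual x)) (fun u v => D (ofDual v) (ofDual u)) where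
  sup h h' := by rw [H.sup (ofDual_le_ofDual.2 h') (ofDual_le_ofDual.2 h), sup_comm]
  disjoint h h' := (H.disjoint (ofDual_le_ofDual.2 h') (ofDual_le_ofDual.2 h)).symm
  sub_mem h := by rw [← neg_sub]; exact neg_mem (H.sub_mem (ofDual_le_ofDual.2 h))
  covBy h := by
    rw [H.covBy h.ofDual, ← neg_sub, ← Set.neg_singleton, Submodule.span_neg]
  ne_of_covBy h := (H.ne_of_covBy h.ofDual).symm
  diamond h h' := by
    obtain ⟨m, h1, h2, h3⟩ := H.diamond h'.ofDual h.ofDual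
    exact ⟨toDual m, h1, h3.toDual, h2.toDual⟩
  atoms_indep h h' hne := H.coatoms_indep h.ofDual h'.ofDual hne
  coatoms_indep h h' hne := H.atoms_indep h.ofDual h'.ofDual hne
  facet_atom h1 h2 h3 h4 := H.facet_coatom h4.ofDual (ofDual_le_ofDual.2 h3)
    (ofDual_le_ofDual.2 h2) h1.ofDual
  facet_coatom h1 h2 h3 h4 := H.facet_atom h4.ofDual (ofDual_le_ofDual.2 h3)
    (ofDual_le_ofDual.2 h2) h1.ofDual

lemma mono (H : IsToricPoset φ D) (h1 : u ≤ x) (h2 : x ≤ y) (h3 : y ≤ v) : D x y ≤ D u v := by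
  rw [H.sup h1 (h2.trans h3), H.sup h2 h3]
  exact le_sup_left.trans le_sup_right

lemma self_eq_bot (H : IsToricPoset φ D) (u : X) : D u u = ⊥ :=
  disjoint_self.1 (H.disjoint le_rfl le_rfl)

lemma inner_eq (H : IsToricPoset φ D) {h : E} (hh : h ∈ (D u v)ᗮ) (h1 : u ≤ x) (h2 : x ≤ y)
    (h3 : y ≤ v) : ⟪h, φ x⟫ = ⟪h, φ y⟫ := by
  have := (Submodule.mem_orthogonal' _ _).1 hh _ (H.mono h1 h2 h3 (H.sub_mem h2))
  rw [inner_sub_right] at this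
  linarith

lemma sub_notMem (H : IsToricPoset φ D) (h1 : u ⋖ a) (h2 : a ≤ v) : φ a - φ u ∉ D a v := by
  intro h
  have := Submodule.disjoint_def.1 (H.disjoint h1.le h2) _ (H.sub_mem h1.le) h
  exact H.ne_of_covBy h1 (sub_eq_zero.1 this).symm

section FiniteDimensional

variable [FiniteDimensional ℝ E]

lemma exists_normal (H : IsToricPoset φ D) (h1 : u ⋖ a) (h2 : a ≤ v) :
    ∃ h ∈ (D a v)ᗮ, ⟪h, φ u⟫ < ⟪h, φ a⟫ := by
  have h3 := H.sub_notMem h1 h2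
  rw [← Submodule.orthogonal_orthogonal (D a v), Submodule.mem_orthogonal] at h3
  push Not at h3
  obtain ⟨h, hh, hne⟩ := h3
  rw [inner_sub_right, sub_ne_zero] at hne
  rcases hne.lt_or_gt with hlt | hlt
  · exact ⟨-h, neg_mem hh, by rw [inner_neg_left, inner_neg_left]; linarith⟩
  · exact ⟨h, hh, hlt⟩

/-- The quadrilateral of an interval of length two is convex at its top. -/
lemma exists_cone (H : IsToricPoset φ D) {a' : X} (h1 : u ⋖ a) (h2 : a ⋖ v) (h1' : u ⋖ a')
    (h2' : a' ⋖ v) (hne : a ≠ a') : ∃ A B : ℝ, 0 ≤ A ∧ 0 ≤ B ∧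
      φ u - φ v = A • (φ a - φ v) + B • (φ a' - φ v) := by
  have h3 : φ a' - φ v ∈ D u v := by
    rw [← neg_sub]
    exact neg_mem (H.mono h1'.le h2'.le le_rfl (H.sub_mem h2'.le))
  rw [H.sup h1.le h2.le, H.covBy h1, H.covBy h2, Submodule.mem_sup] at h3
  obtain ⟨p, hp, q, hq, hpq⟩ := h3
  obtain ⟨s, rfl⟩ := Submodule.mem_span_singleton.1 hp
  obtain ⟨t, rfl⟩ := Submodule.mem_span_singleton.1 hq
  have hs : s ≠ 0 := by
    rintro rfl
    refine H.coatoms_indep h2 h2' hne ?_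
    rw [← hpq, H.covBy h2, zero_smul, zero_add]
    exact Submodule.smul_mem _ _ (Submodule.mem_span_singleton_self _)
  have key : φ u - φ v = (1 - s⁻¹ * t) • (φ a - φ v) + (-s⁻¹) • (φ a' - φ v) := by
    rw [← hpq, smul_add, smul_smul, smul_smul, neg_mul, inv_mul_cancel₀ hs]
    module
  obtain ⟨k, hk, hk'⟩ := H.exists_normal h1 h2.le
  obtain ⟨k', hk1, hk1'⟩ := H.exists_normal h1' h2'.le
  have e1 := congrArg (fun z => ⟪k, z⟫) key
  have e2 := congrArg (fun z => ⟪k', z⟫) key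
  simp only [inner_add_right, inner_sub_right, real_inner_smul_right] at e1 e2
  have f1 := H.facet_atom h1 h2.le h1'.le h2' k hk hk'.le
  have f2 := H.facet_atom h1' h2'.le h1.le h2 k' hk1 hk1'.le
  rw [H.inner_eq hk le_rfl h2.le le_rfl] at hk' e1
  rw [H.inner_eq hk1 le_rfl h2'.le le_rfl] at hk1' e2
  refine ⟨_, _, ?_, ?_, key⟩
  · by_contra hc
    push Not at hc
    nlinarith
  · by_contra hc
    push Not at hc
    nlinarith

variable [Finite X]

lemma ncard_Icc_lt {u' v' : X} (huv : u ≤ v) (h1 : u ≤ u') (h2 : v' ≤ v) (hne : u ≠ u' ∨ v' ≠ v) :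
    (Set.Icc u' v').ncard < (Set.Icc u v).ncard := by
  refine Set.ncard_lt_ncard ⟨Set.Icc_subset_Icc h1 h2, fun h => ?_⟩ (Set.toFinite _)
  have h3 := h (Set.left_mem_Icc.2 huv)
  have h4 := h (Set.right_mem_Icc.2 huv)
  rcases hne with hne | hne
  · exact hne (le_antisymm h1 h3.1)
  · exact hne (le_antisymm h2 h4.2)

/-- The polytope of `[u, v]` lies in the cone spanned at its top vertex by the edges to the coatoms.

For the bottom vertex `u`, a functional `F` that is bounded by `F v` at the coatoms is changed by a
functional that does not distinguish `u` from `v`, until its value at some coatom `b` is `F v`;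
then the interval `[u, b]` bounds `F u`. -/
theorem le_top (H : IsToricPoset φ D) (huv : u ≤ v) (F : E)
    (hF : ∀ b, u ≤ b → b ⋖ v → ⟪F, φ b⟫ ≤ ⟪F, φ v⟫) :
    ∀ x, u ≤ x → x ≤ v → ⟪F, φ x⟫ ≤ ⟪F, φ v⟫ := by
  induction hn : (Set.Icc u v).ncard using Nat.strong_induction_on generalizing u v F with
  | _ n ih =>
  subst hn
  have hup : ∀ F : E, (∀ b, u ≤ b → b ⋖ v → ⟪F, φ b⟫ ≤ ⟪F, φ v⟫) →
      ∀ x, u < x → x ≤ v → ⟪F, φ x⟫ ≤ ⟪F, φ v⟫ := by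
    intro F hF x hux hxv
    obtain ⟨a, ha, hax⟩ := hux.exists_covby_le
    exact ih _ (ncard_Icc_lt huv ha.le le_rfl (Or.inl ha.ne)) (hax.trans hxv) F
      (fun b hab hb => hF b (ha.le.trans hab) hb) rfl x hax hxv
  intro x hux hxv
  rcases hux.eq_or_lt with rfl | hux
  swap
  · exact hup F hF x hux hxv
  rcases huv.eq_or_lt with rfl | huv'
  · rfl
  by_cases hcov : ∃ a, u ⋖ a ∧ a ⋖ v
  · obtain ⟨a, h1, h2⟩ := hcov
    obtain ⟨a', hne, h1', h2'⟩ := H.diamond h1 h2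
    obtain ⟨A, B, hA, hB, e⟩ := H.exists_cone h1 h2 h1' h2' hne.symm
    have e1 := congrArg (fun z => ⟪F, z⟫) e
    simp only [inner_add_right, inner_sub_right, real_inner_smul_right] at e1
    have := mul_le_mul_of_nonneg_left (hF a h1.le h2) hA
    have := mul_le_mul_of_nonneg_left (hF a' h1'.le h2') hB
    linarith
  obtain ⟨b₀, hub, hb⟩ := huv'.exists_le_covby
  rcases hub.eq_or_lt with rfl | hub'
  · exact hF u le_rfl hb
  by_contra hlt
  push Not at hlt
  -- a functional that does not distinguish `u` and `v`
  obtain ⟨G, hG, hGb⟩ : ∃ G : E, ⟪G, φ u⟫ = ⟪G, φ v⟫ ∧ ⟪G, φ v⟫ < ⟪G, φ b₀⟫ := by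
    have h1 : φ b₀ - φ v ∉ Submodule.span ℝ {φ u - φ v} := by
      rw [Submodule.mem_span_singleton]
      rintro ⟨t, ht⟩
      have h2 : (1 - t) • (φ b₀ - φ v) ∈ D u b₀ := by
        have : (1 - t) • (φ b₀ - φ v) = t • (φ u - φ b₀) := by
          have : t • (φ u - φ b₀) = t • (φ u - φ v) - t • (φ b₀ - φ v) := by module
          rw [this, ht]; module
        rw [this, ← neg_sub]
        exact Submodule.smul_mem _ _ (neg_mem (H.sub_mem hub))
      have h3 : (1 - t) • (φ b₀ - φ v) ∈ D b₀ v := by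
        rw [← neg_sub (φ v)]
        exact Submodule.smul_mem _ _ (neg_mem (H.sub_mem hb.le))
      have h4 := Submodule.disjoint_def.1 (H.disjoint hub hb.le) _ h2 h3
      rcases smul_eq_zero.1 h4 with h5 | h5
      · have ht1 : t = 1 := by linarith
        rw [ht1, one_smul, sub_left_inj] at ht
        have h6 : φ u = φ b₀ := ht
        obtain ⟨a, ha, hab⟩ := hub'.exists_covby_le
        refine H.sub_notMem ha hab ?_
        rw [h6, ← neg_sub]
        exact neg_mem (H.sub_mem hab)
      · exact H.ne_of_covBy hb (sub_eq_zero.1 h5)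
    rw [← Submodule.orthogonal_orthogonal (Submodule.span ℝ _), Submodule.mem_orthogonal] at h1
    push Not at h1
    obtain ⟨G, hG, hne⟩ := h1
    have hG' := (Submodule.mem_orthogonal' _ _).1 hG _ (Submodule.mem_span_singleton_self _)
    rw [inner_sub_right, sub_eq_zero] at hG'
    rw [inner_sub_right, sub_ne_zero] at hne
    rcases hne.lt_or_gt with h | h
    · exact ⟨-G, by simpa using hG', by simpa using h⟩
    · exact ⟨G, hG', h⟩
  obtain ⟨b₁, ⟨⟨hub₁, hb₁⟩, hGb₁⟩, hmin⟩ := Set.exists_min_image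
    {b | (u ≤ b ∧ b ⋖ v) ∧ ⟪G, φ v⟫ < ⟪G, φ b⟫}
    (fun b => (⟪F, φ v⟫ - ⟪F, φ b⟫) / (⟪G, φ b⟫ - ⟪G, φ v⟫)) (Set.toFinite _)
    ⟨b₀, ⟨hub, hb⟩, hGb⟩
  set τ := (⟪F, φ v⟫ - ⟪F, φ b₁⟫) / (⟪G, φ b₁⟫ - ⟪G, φ v⟫) with hτ
  have hτ0 : 0 ≤ τ := div_nonneg (sub_nonneg.2 (hF b₁ hub₁ hb₁)) (sub_nonneg.2 hGb₁.le)
  have hF' : ∀ b, u ≤ b → b ⋖ v → ⟪F + τ • G, φ b⟫ ≤ ⟪F + τ • G, φ v⟫ := by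
    intro b h1 h2
    simp only [inner_add_left, real_inner_smul_left]
    rcases le_or_gt ⟪G, φ b⟫ ⟪G, φ v⟫ with h | h
    · have := hF b h1 h2
      have := mul_le_mul_of_nonneg_left h hτ0
      linarith
    · have := hmin b ⟨⟨h1, h2⟩, h⟩
      rw [le_div_iff₀ (sub_pos.2 h)] at this
      linarith
  have heq : ⟪F + τ • G, φ b₁⟫ = ⟪F + τ • G, φ v⟫ := by
    simp only [inner_add_left, real_inner_smul_left]
    have : τ * (⟪G, φ b₁⟫ - ⟪G, φ v⟫) = ⟪F, φ v⟫ - ⟪F, φ b₁⟫ :=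
      div_mul_cancel₀ _ (sub_pos.2 hGb₁).ne'
    linarith
  have hub₁' : ¬ u ⋖ b₁ := fun h => hcov ⟨b₁, h, hb₁⟩
  have := ih _ (ncard_Icc_lt huv le_rfl hb₁.le (Or.inr hb₁.ne)) hub₁ (F + τ • G) (by
    intro y huy hy
    rw [heq]
    refine hup _ hF' y (huy.lt_of_ne ?_) (hy.le.trans hb₁.le)
    rintro rfl
    exact hub₁' hy) rfl u le_rfl hub₁
  rw [heq] at this
  simp only [inner_add_left, real_inner_smul_left, hG] at this
  linarith

/-- The hyperplane of `[a, v]`, for an atom `a` of `[u, v]`, supports the polytope of `[u, v]`. -/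
theorem facet_atom_le (H : IsToricPoset φ D) (h1 : u ⋖ a) (h2 : a ≤ v) {h : E}
    (hh : h ∈ (D a v)ᗮ) (hu : ⟪h, φ u⟫ ≤ ⟪h, φ a⟫) (h3 : u ≤ x) (h4 : x ≤ v) :
    ⟪h, φ x⟫ ≤ ⟪h, φ v⟫ := by
  rcases h3.eq_or_lt with rfl | h3
  · rwa [← H.inner_eq hh le_rfl h2 le_rfl]
  · obtain ⟨a', ha', hax⟩ := h3.exists_covby_le
    exact H.le_top (hax.trans h4) h
      (fun b hab hb => H.facet_atom h1 h2 (ha'.le.trans hab) hb h hh hu) x hax h4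

end FiniteDimensional

end IsToricPoset

end Toric

section Toric

variable {X E : Type*} [PartialOrder X] [NormedAddCommGroup E] [InnerProductSpace ℝ E]

/-- The facet description of the polytope spanned by `[u, v]`: the points of its affine
span that satisfy the inequalities given by the hyperplanes of `[a, v]` and `[u, b]`, for the atoms
`a` and the coatoms `b` of `[u, v]`. -/
def InCell (φ : X → E) (D : X → X → Submodule ℝ E) (u v : X) (y : E) : Prop :=
  y - φ u ∈ D u v ∧
  (∀ a, u ⋖ a → a ≤ v → ∀ h ∈ (D a v)ᗮ, ⟪h, φ u⟫ ≤ ⟪h, φ a⟫ → ⟪h, y⟫ ≤ ⟪h, φ v⟫) ∧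
  (∀ b, u ≤ b → b ⋖ v → ∀ h ∈ (D u b)ᗮ, ⟪h, φ v⟫ ≤ ⟪h, φ b⟫ → ⟪h, y⟫ ≤ ⟪h, φ u⟫)

namespace IsToricPoset

variable {φ : X → E} {D : X → X → Submodule ℝ E} {u v a b x y : X}

open OrderDual

lemma inCell_dual (H : IsToricPoset φ D) (huv : u ≤ v) {y : E} :
    InCell (X := Xᵒᵈ) (fun x => φ (ofDual x)) (fun u v => D (ofDual v) (ofDual u))
      (toDual v) (toDual u) y ↔ InCell φ D u v y := by
  have h1 : y - φ v ∈ D u v ↔ y - φ u ∈ D u v := by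
    rw [← Submodule.add_mem_iff_left (D u v) (H.sub_mem huv), sub_add_sub_cancel]
  constructor
  · rintro ⟨h, ha, hb⟩
    exact ⟨h1.1 h, fun a h2 h3 => hb (toDual a) (toDual_le_toDual.2 h3) h2.toDual,
      fun b h2 h3 => ha (toDual b) h3.toDual (toDual_le_toDual.2 h2)⟩
  · rintro ⟨h, ha, hb⟩
    exact ⟨h1.2 h, fun b h2 h3 => hb (ofDual b) (ofDual_le_ofDual.2 h3) h2.ofDual,
      fun a h2 h3 => ha (ofDual a) h3.ofDual (ofDual_le_ofDual.2 h2)⟩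

lemma exists_decomp (H : IsToricPoset φ D) (h1 : u ⋖ a) (h2 : a ≤ v) {y : E}
    (hy : y - φ u ∈ D u v) :
    ∃ s : ℝ, ∃ q ∈ D a v, s • (φ a - φ u) + q = y - φ u ∧
      ∀ h ∈ (D a v)ᗮ, ⟪h, y⟫ - ⟪h, φ u⟫ = s * (⟪h, φ v⟫ - ⟪h, φ u⟫) := by
  rw [H.sup h1.le h2, H.covBy h1, Submodule.mem_sup] at hy
  obtain ⟨p, hp, q, hq, hpq⟩ := hy
  obtain ⟨s, rfl⟩ := Submodule.mem_span_singleton.1 hp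
  refine ⟨s, q, hq, hpq, fun h hh => ?_⟩
  have e := congrArg (fun z => ⟪h, z⟫) hpq
  simp only [inner_add_right, inner_sub_right, real_inner_smul_right] at e
  rw [(Submodule.mem_orthogonal' _ _).1 hh q hq, H.inner_eq hh le_rfl h2 le_rfl] at e
  linarith

/-- All normals of the hyperplane of `[a, v]` give the same inequality on the affine span. -/
lemma le_of_normal (H : IsToricPoset φ D) (h1 : u ⋖ a) (h2 : a ≤ v) {k h y : E}
    (hk : k ∈ (D a v)ᗮ) (hku : ⟪k, φ u⟫ < ⟪k, φ a⟫) (hh : h ∈ (D a v)ᗮ)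
    (hhu : ⟪h, φ u⟫ ≤ ⟪h, φ a⟫) (hy : y - φ u ∈ D u v) (hky : ⟪k, y⟫ ≤ ⟪k, φ v⟫) :
    ⟪h, y⟫ ≤ ⟪h, φ v⟫ := by
  obtain ⟨s, q, -, -, hs⟩ := H.exists_decomp h1 h2 hy
  rw [H.inner_eq hk le_rfl h2 le_rfl] at hku
  rw [H.inner_eq hh le_rfl h2 le_rfl] at hhu
  have e1 := hs k hk
  have e2 := hs h hh
  have h3 : s ≤ 1 := by
    by_contra hc
    push Not at hc
    nlinarith
  nlinarith

lemma InCell.convex (φ : X → E) (D : X → X → Submodule ℝ E) (u v : X) :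
    Convex ℝ {y | InCell φ D u v y} := by
  have key : ∀ (h y z : E) (s t r : ℝ), 0 ≤ s → 0 ≤ t → s + t = 1 → ⟪h, y⟫ ≤ r → ⟪h, z⟫ ≤ r →
      ⟪h, s • y + t • z⟫ ≤ r := by
    intro h y z s t r hs ht hst h1 h2
    rw [inner_add_right, real_inner_smul_right, real_inner_smul_right]
    have := mul_le_mul_of_nonneg_left h1 hs
    have := mul_le_mul_of_nonneg_left h2 ht
    have : s * r + t * r = r := by rw [← add_mul, hst, one_mul]
    linarith
  rintro y ⟨hy, hya, hyb⟩ z ⟨hz, hza, hzb⟩ s t hs ht hst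
  refine ⟨?_, fun a h1 h2 h h3 h4 => key _ _ _ _ _ _ hs ht hst (hya a h1 h2 h h3 h4)
    (hza a h1 h2 h h3 h4), fun b h1 h2 h h3 h4 => key _ _ _ _ _ _ hs ht hst (hyb b h1 h2 h h3 h4)
    (hzb b h1 h2 h h3 h4)⟩
  have : s • y + t • z - φ u = s • (y - φ u) + t • (z - φ u) := by
    rw [smul_sub, smul_sub, sub_add_sub_comm, ← add_smul, hst, one_smul]
  rw [this]
  exact add_mem (Submodule.smul_mem _ _ hy) (Submodule.smul_mem _ _ hz)

section FiniteDimensional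

variable [FiniteDimensional ℝ E]

/-- A point of the cell of `[u, v]` on the hyperplane of `[a, v]` lies in the cell of `[a, v]`.

On this hyperplane, every inequality of the cell of `[a, v]` is an inequality of the cell of
`[u, v]`, since a normal `h` can be changed by a multiple of the normal `k` of the hyperplane. For
an atom `a₂` of `[a, v]`, the multiple is chosen so that `h + τ k` is constant on `[a', v]`,
where `a'` is the second middle element of `[u, a₂]`; for a coatom it is chosen so that `h + τ k` is constant on
`[u, b]`. -/
theorem inCell_of_active (H : IsToricPoset φ D) (h1 : u ⋖ a) (h2 : a ≤ v) {k y : E}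
    (hk : k ∈ (D a v)ᗮ) (hku : ⟪k, φ u⟫ < ⟪k, φ a⟫) (hy : InCell φ D u v y)
    (hky : ⟪k, y⟫ = ⟪k, φ v⟫) : InCell φ D a v y := by
  obtain ⟨hyD, hya, hyb⟩ := hy
  have hkav : ∀ {z}, a ≤ z → z ≤ v → ⟪k, φ z⟫ = ⟪k, φ v⟫ := fun h3 h4 =>
    H.inner_eq hk h3 h4 le_rfl
  rw [hkav le_rfl h2] at hku
  refine ⟨?_, ?_, ?_⟩
  · obtain ⟨s, q, hq, hsq, hs⟩ := H.exists_decomp h1 h2 hyD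
    have e := hs k hk
    rw [hky] at e
    have hs1 : s = 1 := by
      have : (s - 1) * (⟪k, φ v⟫ - ⟪k, φ u⟫) = 0 := by linarith
      rcases mul_eq_zero.1 this with h | h <;> linarith
    rw [hs1, one_smul] at hsq
    have : y - φ a = q := by
      rw [← sub_eq_iff_eq_add'.2 hsq.symm]
      abel
    rwa [this]
  · intro a₂ h3 h4 h hh hhu
    obtain ⟨a', hne, h1', h3'⟩ := H.diamond h1 h3
    obtain ⟨A, B, hA, hB, e⟩ := H.exists_cone h1 h3 h1' h3' hne.symm
    have e1 := congrArg (fun z => ⟪k, z⟫) e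
    have e2 := congrArg (fun z => ⟪h, z⟫) e
    simp only [inner_add_right, inner_sub_right, real_inner_smul_right] at e1 e2
    rw [hkav h3.le h4, hkav le_rfl h2] at e1
    have hka' : ⟪k, φ a'⟫ < ⟪k, φ v⟫ := by
      by_contra hc
      push Not at hc
      have := mul_nonneg hB (sub_nonneg.2 hc)
      linarith
    set τ := (⟪h, φ a'⟫ - ⟪h, φ a₂⟫) / (⟪k, φ v⟫ - ⟪k, φ a'⟫) with hτ
    have hτ' : τ * (⟪k, φ v⟫ - ⟪k, φ a'⟫) = ⟪h, φ a'⟫ - ⟪h, φ a₂⟫ :=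
      div_mul_cancel₀ _ (sub_pos.2 hka').ne'
    have h5 := hya a' h1' (h3'.le.trans h4) (h + τ • k) ?_ ?_
    · simp only [inner_add_left, real_inner_smul_left, hky] at h5
      linarith
    · rw [H.sup h3'.le h4, Submodule.mem_orthogonal', H.covBy h3']
      intro z hz
      obtain ⟨p, hp, q, hq, rfl⟩ := Submodule.mem_sup.1 hz
      obtain ⟨s, rfl⟩ := Submodule.mem_span_singleton.1 hp
      have hkq := (Submodule.mem_orthogonal' _ _).1 hk q (H.mono h3.le h4 le_rfl hq)
      have hhq := (Submodule.mem_orthogonal' _ _).1 hh q hq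
      simp only [inner_add_left, inner_add_right, real_inner_smul_left, real_inner_smul_right,
        inner_sub_right, hkq, hhq, hkav h3.le h4]
      linear_combination s * hτ'
    · simp only [inner_add_left, real_inner_smul_left]
      have h6 : (⟪k, φ u⟫ - ⟪k, φ v⟫) * τ = -(B * (⟪h, φ a'⟫ - ⟪h, φ a₂⟫)) := by
        rw [← hτ', e1]; ring
      have h7 := mul_nonneg hA (sub_nonneg.2 hhu)
      linarith
  · intro b h3 h4 h hh hhv
    have hpos : 0 < ⟪k, φ v⟫ - ⟪k, φ u⟫ := sub_pos.2 hku
    set τ := (⟪h, φ u⟫ - ⟪h, φ a⟫) / (⟪k, φ v⟫ - ⟪k, φ u⟫) with hτ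
    have hτ' : τ * (⟪k, φ v⟫ - ⟪k, φ u⟫) = ⟪h, φ u⟫ - ⟪h, φ a⟫ := div_mul_cancel₀ _ hpos.ne'
    have h5 := hyb b (h1.le.trans h3) h4 (h + τ • k) ?_ ?_
    · simp only [inner_add_left, real_inner_smul_left, hky] at h5
      linarith
    · rw [H.sup h1.le h3, Submodule.mem_orthogonal', H.covBy h1]
      intro z hz
      obtain ⟨p, hp, q, hq, rfl⟩ := Submodule.mem_sup.1 hz
      obtain ⟨s, rfl⟩ := Submodule.mem_span_singleton.1 hp
      have hkq := (Submodule.mem_orthogonal' _ _).1 hk q (H.mono le_rfl h3 h4.le hq)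
      have hhq := (Submodule.mem_orthogonal' _ _).1 hh q hq
      simp only [inner_add_left, inner_add_right, real_inner_smul_left, real_inner_smul_right,
        inner_sub_right, hkq, hhq, hkav le_rfl h2]
      linear_combination s * hτ'
    · simp only [inner_add_left, real_inner_smul_left, hkav h3 h4.le]
      linarith

lemma inCell_of_active_coatom (H : IsToricPoset φ D) (h1 : u ≤ b) (h2 : b ⋖ v) {k y : E}
    (hk : k ∈ (D u b)ᗮ) (hkv : ⟪k, φ v⟫ < ⟪k, φ b⟫) (hy : InCell φ D u v y)
    (hky : ⟪k, y⟫ = ⟪k, φ u⟫) : InCell φ D u b y :=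
  (H.inCell_dual h1).1 (H.dual.inCell_of_active h2.toDual (toDual_le_toDual.2 h1) hk hkv
    ((H.inCell_dual (h1.trans h2.le)).2 hy) hky)

variable [Finite X]

lemma facet_coatom_le (H : IsToricPoset φ D) (h1 : u ≤ b) (h2 : b ⋖ v) {h : E}
    (hh : h ∈ (D u b)ᗮ) (hv : ⟪h, φ v⟫ ≤ ⟪h, φ b⟫) (h3 : u ≤ x) (h4 : x ≤ v) :
    ⟪h, φ x⟫ ≤ ⟪h, φ u⟫ :=
  H.dual.facet_atom_le (x := toDual x) h2.toDual (toDual_le_toDual.2 h1) hh hv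
    (toDual_le_toDual.2 h4) (toDual_le_toDual.2 h3)

/-- The line through a point of a cell in the direction from the bottom to the top vertex leaves the
cell through the cell of `[a, v]` for some atom `a`. -/
lemma exists_inCell_atom (H : IsToricPoset φ D) (huv : u < v) {y : E} (hy : InCell φ D u v y) :
    ∃ t : ℝ, 0 ≤ t ∧ ∃ a, u ⋖ a ∧ a ≤ v ∧ InCell φ D a v (y + t • (φ v - φ u)) := by
  have hex : ∀ a : X, ∃ k : E, u ⋖ a → a ≤ v → k ∈ (D a v)ᗮ ∧ ⟪k, φ u⟫ < ⟪k, φ a⟫ ∧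
      ⟪k, φ a⟫ = ⟪k, φ v⟫ := by
    intro a
    by_cases h1 : u ⋖ a ∧ a ≤ v
    · obtain ⟨k, hk, hku⟩ := H.exists_normal h1.1 h1.2
      exact ⟨k, fun _ _ => ⟨hk, hku, H.inner_eq hk le_rfl h1.2 le_rfl⟩⟩
    · exact ⟨0, fun h2 h3 => absurd ⟨h2, h3⟩ h1⟩
  choose k hk using hex
  obtain ⟨a₀, h1, h2⟩ := huv.exists_covby_le
  obtain ⟨a, ⟨h1, h2⟩, hmin⟩ := Set.exists_min_image {a | u ⋖ a ∧ a ≤ v}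
    (fun a => (⟪k a, φ v⟫ - ⟪k a, y⟫) / (⟪k a, φ v⟫ - ⟪k a, φ u⟫)) (Set.toFinite _) ⟨a₀, h1, h2⟩
  set t := (⟪k a, φ v⟫ - ⟪k a, y⟫) / (⟪k a, φ v⟫ - ⟪k a, φ u⟫) with ht
  obtain ⟨hka, hku, hkv⟩ := hk a h1 h2
  have hpos : 0 < ⟪k a, φ v⟫ - ⟪k a, φ u⟫ := by linarith
  have ht0 : 0 ≤ t := div_nonneg (sub_nonneg.2 (hy.2.1 a h1 h2 _ hka hku.le)) hpos.le
  have ht' : t * (⟪k a, φ v⟫ - ⟪k a, φ u⟫) = ⟪k a, φ v⟫ - ⟪k a, y⟫ := div_mul_cancel₀ _ hpos.ne'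
  refine ⟨t, ht0, a, h1, h2, H.inCell_of_active h1 h2 hka hku ?_ ?_⟩
  · have hD : y + t • (φ v - φ u) - φ u ∈ D u v := by
      rw [add_sub_right_comm]
      exact add_mem hy.1 (Submodule.smul_mem _ _ (H.sub_mem huv.le))
    refine ⟨hD, fun a' h1' h2' h hh hhu => ?_, fun b h3 h4 h hh hhv => ?_⟩
    · obtain ⟨hka', hku', hkv'⟩ := hk a' h1' h2'
      have hpos' : 0 < ⟪k a', φ v⟫ - ⟪k a', φ u⟫ := by linarith
      refine H.le_of_normal h1' h2' hka' hku' hh hhu hD ?_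
      have := hmin a' ⟨h1', h2'⟩
      rw [le_div_iff₀ hpos'] at this
      rw [inner_add_right, real_inner_smul_right, inner_sub_right]
      linarith
    · rw [inner_add_right, real_inner_smul_right, inner_sub_right]
      have h5 := hy.2.2 b h3 h4 h hh hhv
      rw [← H.inner_eq hh le_rfl h3 le_rfl] at hhv
      have := mul_le_mul_of_nonneg_left hhv ht0
      linarith
  · rw [inner_add_right, real_inner_smul_right, inner_sub_right]
    linarith

lemma exists_inCell_coatom (H : IsToricPoset φ D) (huv : u < v) {y : E} (hy : InCell φ D u v y) :
    ∃ t : ℝ, 0 ≤ t ∧ ∃ b, u ≤ b ∧ b ⋖ v ∧ InCell φ D u b (y + t • (φ u - φ v)) := by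
  obtain ⟨t, ht, b, h1, h2, h3⟩ := H.dual.exists_inCell_atom (toDual_lt_toDual.2 huv)
    ((H.inCell_dual huv.le).2 hy)
  exact ⟨t, ht, ofDual b, h2, h1.ofDual, (H.inCell_dual (v := ofDual b) h2).1 h3⟩

/-- The cell of an interval is the polytope spanned by the interval: a point of the cell lies on a
segment between the cells of `[a, v]` and `[u, b]`, for some atom `a` and some coatom `b`. -/
theorem mem_convexHull_iff (H : IsToricPoset φ D) (huv : u ≤ v) {y : E} :
    y ∈ convexHull ℝ (φ '' Set.Icc u v) ↔ InCell φ D u v y := by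
  constructor
  · intro hy
    refine convexHull_min ?_ (InCell.convex φ D u v) hy
    rintro _ ⟨x, ⟨h1, h2⟩, rfl⟩
    exact ⟨H.mono le_rfl h1 h2 (H.sub_mem h1),
      fun a h3 h4 h hh hu => H.facet_atom_le h3 h4 hh hu h1 h2,
      fun b h3 h4 h hh hv => H.facet_coatom_le h3 h4 hh hv h1 h2⟩
  · intro hy
    induction hn : (Set.Icc u v).ncard using Nat.strong_induction_on generalizing u v y with
    | _ n ih =>
    subst hn
    rcases huv.eq_or_lt with rfl | huv'
    · have h1 := hy.1
      rw [H.self_eq_bot, Submodule.mem_bot, sub_eq_zero] at h1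
      exact subset_convexHull _ _ ⟨u, ⟨le_rfl, le_rfl⟩, h1.symm⟩
    obtain ⟨t, ht, a, h1, h2, h3⟩ := H.exists_inCell_atom huv' hy
    obtain ⟨s, hs, b, h4, h5, h6⟩ := H.exists_inCell_coatom huv' hy
    have m1 := convexHull_mono (Set.image_mono (Set.Icc_subset_Icc h1.le le_rfl))
      (ih _ (ncard_Icc_lt huv h1.le le_rfl (Or.inl h1.ne)) h2 h3 rfl)
    have m2 := convexHull_mono (Set.image_mono (Set.Icc_subset_Icc le_rfl h5.le))
      (ih _ (ncard_Icc_lt huv le_rfl h5.le (Or.inr h5.ne)) h4 h6 rfl)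
    rcases (add_nonneg hs ht).eq_or_lt with h0 | h0
    · have : t = 0 := by linarith
      rwa [this, zero_smul, add_zero] at m1
    · have := convex_convexHull ℝ (φ '' Set.Icc u v) m1 m2 (div_nonneg hs h0.le)
        (div_nonneg ht h0.le) (by field_simp)
      convert this using 1
      have e1 : s / (s + t) + t / (s + t) = 1 := by field_simp
      have e2 : s / (s + t) * t = t / (s + t) * s := by field_simp
      have : (s / (s + t)) • (y + t • (φ v - φ u)) + (t / (s + t)) • (y + s • (φ u - φ v)) =
          (s / (s + t) + t / (s + t)) • y + (s / (s + t) * t - t / (s + t) * s) • (φ v - φ u) := by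
        module
      rw [this, e1, e2, sub_self, zero_smul, one_smul, add_zero]

lemma eventually_inCell (H : IsToricPoset φ D) {m d : E} (hm : InCell φ D u v m)
    (hd : d ∈ D u v)
    (hA : ∀ a, u ⋖ a → a ≤ v → ∀ k ∈ (D a v)ᗮ, ⟪k, φ u⟫ < ⟪k, φ a⟫ → ⟪k, m⟫ ≠ ⟪k, φ v⟫)
    (hB : ∀ b, u ≤ b → b ⋖ v → ∀ k ∈ (D u b)ᗮ, ⟪k, φ v⟫ < ⟪k, φ b⟫ → ⟪k, m⟫ ≠ ⟪k, φ u⟫) :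
    ∀ᶠ ε : ℝ in nhds 0, InCell φ D u v (m + ε • d) := by
  have key : ∀ (k : E) (r : ℝ), ⟪k, m⟫ < r → ∀ᶠ ε : ℝ in nhds 0, ⟪k, m + ε • d⟫ < r := by
    intro k r h
    refine (Continuous.tendsto (f := fun ε : ℝ => ⟪k, m + ε • d⟫) (by fun_prop)
      0).eventually_lt_const ?_
    simpa using h
  have hD : ∀ ε : ℝ, m + ε • d - φ u ∈ D u v := fun ε => by
    rw [add_sub_right_comm]
    exact add_mem hm.1 (Submodule.smul_mem _ _ hd)
  have h1 : ∀ a, ∀ᶠ ε : ℝ in nhds 0, u ⋖ a → a ≤ v → ∀ h ∈ (D a v)ᗮ,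
      ⟪h, φ u⟫ ≤ ⟪h, φ a⟫ → ⟪h, m + ε • d⟫ ≤ ⟪h, φ v⟫ := by
    intro a
    by_cases ha : u ⋖ a ∧ a ≤ v
    · obtain ⟨k, hk, hku⟩ := H.exists_normal ha.1 ha.2
      filter_upwards [key k _ ((hm.2.1 a ha.1 ha.2 k hk hku.le).lt_of_ne (hA a ha.1 ha.2 k hk hku))]
        with ε hε _ _ h hh hhu
      exact H.le_of_normal ha.1 ha.2 hk hku hh hhu (hD ε) hε.le
    · exact Filter.Eventually.of_forall fun ε h1 h2 => absurd ⟨h1, h2⟩ ha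
  have h2 : ∀ b, ∀ᶠ ε : ℝ in nhds 0, u ≤ b → b ⋖ v → ∀ h ∈ (D u b)ᗮ,
      ⟪h, φ v⟫ ≤ ⟪h, φ b⟫ → ⟪h, m + ε • d⟫ ≤ ⟪h, φ u⟫ := by
    intro b
    by_cases hb : u ≤ b ∧ b ⋖ v
    · obtain ⟨k, hk, hkv⟩ := H.dual.exists_normal hb.2.toDual (toDual_le_toDual.2 hb.1)
      filter_upwards [key k _ ((hm.2.2 b hb.1 hb.2 k hk hkv.le).lt_of_ne (hB b hb.1 hb.2 k hk hkv))]
        with ε hε _ _ h hh hhv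
      refine H.dual.le_of_normal hb.2.toDual (toDual_le_toDual.2 hb.1) hk hkv hh hhv ?_ hε.le
      have := Submodule.sub_mem _ (hD ε) (H.sub_mem (hb.1.trans hb.2.le))
      rwa [sub_sub_sub_cancel_right] at this
    · exact Filter.Eventually.of_forall fun ε h1 h2 => absurd ⟨h1, h2⟩ hb
  filter_upwards [Filter.eventually_all.2 h1, Filter.eventually_all.2 h2] with ε ha hb
  exact ⟨hD ε, ha, hb⟩

/-- Every edge of the polytope of an interval is parallel to the segment of a covering relation: its
midpoint lies on the hyperplane of an atom or a coatom unless the interval is itself a covering. -/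
theorem exists_covBy_of_isExtreme (H : IsToricPoset φ D) (huv : u ≤ v) {x y : E} (hxy : x ≠ y)
    (hS : IsExtreme ℝ (convexHull ℝ (φ '' Set.Icc u v)) (segment ℝ x y)) :
    ∃ p q, p ⋖ q ∧ y - x ∈ D p q := by
  induction hn : (Set.Icc u v).ncard using Nat.strong_induction_on generalizing u v with
  | _ n ih =>
  subst hn
  have hx := (H.mem_convexHull_iff huv).1 (hS.1 (left_mem_segment ℝ x y))
  have hy := (H.mem_convexHull_iff huv).1 (hS.1 (right_mem_segment ℝ x y))
  have hmS : midpoint ℝ x y ∈ segment ℝ x y := midpoint_mem_segment x y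
  have hm := (H.mem_convexHull_iff huv).1 (hS.1 hmS)
  have hxyD : y - x ∈ D u v := by
    have := Submodule.sub_mem _ hy.1 hx.1
    rwa [sub_sub_sub_cancel_right] at this
  have hmid : ∀ k : E, ⟪k, midpoint ℝ x y⟫ = (⟪k, x⟫ + ⟪k, y⟫) / 2 := by
    intro k
    rw [midpoint_eq_smul_add, real_inner_smul_right, inner_add_right, invOf_eq_inv]
    ring
  rcases huv.eq_or_lt with rfl | huv'
  · rw [H.self_eq_bot, Submodule.mem_bot, sub_eq_zero] at hxyD
    exact absurd hxyD.symm hxy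
  by_cases hA : ∃ a, u ⋖ a ∧ a ≤ v ∧ ∃ k ∈ (D a v)ᗮ, ⟪k, φ u⟫ < ⟪k, φ a⟫ ∧
      ⟪k, midpoint ℝ x y⟫ = ⟪k, φ v⟫
  · obtain ⟨a, h1, h2, k, hk, hku, hkm⟩ := hA
    have ex := hx.2.1 a h1 h2 k hk hku.le
    have ey := hy.2.1 a h1 h2 k hk hku.le
    rw [hmid] at hkm
    have hx' := H.inCell_of_active h1 h2 hk hku hx (by linarith)
    have hy' := H.inCell_of_active h1 h2 hk hku hy (by linarith)
    refine ih _ (ncard_Icc_lt huv h1.le le_rfl (Or.inl h1.ne)) h2 (hS.mono ?_ ?_) rfl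
    · exact convexHull_mono (Set.image_mono (Set.Icc_subset_Icc h1.le le_rfl))
    · exact (convex_convexHull _ _).segment_subset ((H.mem_convexHull_iff h2).2 hx')
        ((H.mem_convexHull_iff h2).2 hy')
  by_cases hB : ∃ b, u ≤ b ∧ b ⋖ v ∧ ∃ k ∈ (D u b)ᗮ, ⟪k, φ v⟫ < ⟪k, φ b⟫ ∧
      ⟪k, midpoint ℝ x y⟫ = ⟪k, φ u⟫
  · obtain ⟨b, h1, h2, k, hk, hku, hkm⟩ := hB
    have ex := hx.2.2 b h1 h2 k hk hku.le
    have ey := hy.2.2 b h1 h2 k hk hku.le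
    rw [hmid] at hkm
    have hx' := H.inCell_of_active_coatom h1 h2 hk hku hx (by linarith)
    have hy' := H.inCell_of_active_coatom h1 h2 hk hku hy (by linarith)
    refine ih _ (ncard_Icc_lt huv le_rfl h2.le (Or.inr h2.ne)) h1 (hS.mono ?_ ?_) rfl
    · exact convexHull_mono (Set.image_mono (Set.Icc_subset_Icc le_rfl h2.le))
    · exact (convex_convexHull _ _).segment_subset ((H.mem_convexHull_iff h1).2 hx')
        ((H.mem_convexHull_iff h1).2 hy')
  by_cases hcov : u ⋖ v
  · exact ⟨u, v, hcov, hxyD⟩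
  exfalso
  -- the midpoint can be moved within the polytope in every direction of its affine span
  have hmove : ∀ d ∈ D u v, d ∈ Submodule.span ℝ {y - x} := by
    intro d hd
    have hA' : ∀ a, u ⋖ a → a ≤ v → ∀ k ∈ (D a v)ᗮ, ⟪k, φ u⟫ < ⟪k, φ a⟫ →
        ⟪k, midpoint ℝ x y⟫ ≠ ⟪k, φ v⟫ :=
      fun a h1 h2 k hk hku h => hA ⟨a, h1, h2, k, hk, hku, h⟩
    have hB' : ∀ b, u ≤ b → b ⋖ v → ∀ k ∈ (D u b)ᗮ, ⟪k, φ v⟫ < ⟪k, φ b⟫ →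
        ⟪k, midpoint ℝ x y⟫ ≠ ⟪k, φ u⟫ :=
      fun b h1 h2 k hk hkv h => hB ⟨b, h1, h2, k, hk, hkv, h⟩
    have ev := (H.eventually_inCell hm hd hA' hB').and
      (H.eventually_inCell hm (neg_mem hd) hA' hB')
    obtain ⟨ε, ⟨h1, h2⟩, hε⟩ := ((ev.filter_mono nhdsWithin_le_nhds).and
      (self_mem_nhdsWithin (a := (0 : ℝ)) (s := Set.Ioi 0))).exists
    rw [← H.mem_convexHull_iff huv] at h1 h2
    have h3 : midpoint ℝ x y ∈
        openSegment ℝ (midpoint ℝ x y + ε • d) (midpoint ℝ x y + ε • -d) :=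
      ⟨1 / 2, 1 / 2, by norm_num, by norm_num, by norm_num, by module⟩
    have h4 := hS.2 h1 h2 hmS h3
    rw [segment_eq_image'] at h4 hmS
    obtain ⟨s, -, hs⟩ := h4
    obtain ⟨t, -, ht⟩ := hmS
    simp only at hs ht
    have h5 : ε • d = (s - t) • (y - x) := by
      rw [← ht] at hs
      have : ε • d = (x + t • (y - x) + ε • d) - (x + t • (y - x)) := by abel
      rw [this, ← hs]
      module
    rw [Submodule.mem_span_singleton]
    refine ⟨ε⁻¹ * (s - t), ?_⟩
    rw [mul_smul, ← h5, smul_smul, inv_mul_cancel₀ (ne_of_gt hε), one_smul]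
  obtain ⟨a, h1, h2⟩ := huv'.exists_covby_le
  have hav : a < v := h2.lt_of_ne fun h => hcov (h ▸ h1)
  obtain ⟨a', h3, h4⟩ := hav.exists_covby_le
  have hd1 := H.sub_mem h1.le
  have hd2 := H.mono le_rfl h3.le h4 (H.sub_mem h3.le)
  obtain ⟨s, hs⟩ := Submodule.mem_span_singleton.1 (hmove _ (H.mono le_rfl h1.le h2 hd1))
  obtain ⟨t, ht⟩ := Submodule.mem_span_singleton.1 (hmove _ (H.mono h1.le h2 le_rfl hd2))
  have hs0 : s ≠ 0 := by
    rintro rfl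
    rw [zero_smul] at hs
    exact H.ne_of_covBy h1 (sub_eq_zero.1 hs.symm).symm
  have h5 : φ a' - φ a ∈ D u a := by
    have : φ a' - φ a = (t * s⁻¹) • (φ a - φ u) := by
      rw [← hs, ← ht, smul_smul, mul_assoc, inv_mul_cancel₀ hs0, mul_one]
    rw [this]
    exact Submodule.smul_mem _ _ hd1
  have h6 := Submodule.disjoint_def.1 (H.disjoint h1.le h2) _ h5 hd2
  exact H.ne_of_covBy h3 (sub_eq_zero.1 h6).symm

end FiniteDimensional

end IsToricPoset

end Toric

/-! ### Faces of polytopes -/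

section Faces

variable {E : Type*} [NormedAddCommGroup E] [InnerProductSpace ℝ E]

/-- `Q` is the solution set of finitely many inequalities `⟪x, n⟫ ≤ a` with normals `n` in `A`. -/
def IsCutOutBy (A : Set E) (Q : Set E) : Prop :=
  ∃ S : Finset (E × ℝ), (∀ p ∈ S, p.1 ∈ A) ∧ Q = {x : E | ∀ p ∈ S, ⟪x, p.1⟫ ≤ p.2}

lemma IsCutOutBy.of_finite {A Q : Set E} {S : Set (E × ℝ)} (hS : S.Finite)
    (hA : ∀ p ∈ S, p.1 ∈ A) (hQ : ∀ x, x ∈ Q ↔ ∀ p ∈ S, ⟪x, p.1⟫ ≤ p.2) : IsCutOutBy A Q :=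
  ⟨hS.toFinset, fun p hp => hA p (hS.mem_toFinset.1 hp), by
    ext x
    simp only [hQ, Set.Finite.mem_toFinset, Set.mem_ofPred_eq]⟩

/-- A face is cut out by the inequalities of the polytope and the negatives of those that are
equalities on the whole face. -/
theorem IsCutOutBy.of_isFace {A Q F : Set E} (hA : ∀ n ∈ A, -n ∈ A) (hQ : IsCutOutBy A Q)
    (hF : IsFace Q F) : IsCutOutBy A F := by
  obtain ⟨S, hSA, rfl⟩ := hQ
  obtain ⟨⟨x₀, hx₀⟩, hF⟩ := hF
  obtain ⟨l, hl⟩ := hF ⟨x₀, hx₀⟩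
  have hFQ : ∀ x ∈ F, ∀ p ∈ S, ⟪x, p.1⟫ ≤ p.2 := fun x hx => by
    rw [hl] at hx
    exact hx.1
  have hconv : Convex ℝ F := by
    refine IsExposed.convex hF ?_
    intro x hx y hy s t hs ht hst p hp
    rw [inner_add_left, real_inner_smul_left, real_inner_smul_left]
    have := mul_le_mul_of_nonneg_left (hx p hp) hs
    have := mul_le_mul_of_nonneg_left (hy p hp) ht
    have : s * p.2 + t * p.2 = p.2 := by rw [← add_mul, hst, one_mul]
    linarith
  -- a point of the face at which only the inequalities tight on the whole face are equalities
  obtain ⟨m, hm, hmS⟩ : ∃ m ∈ F, ∀ p ∈ S, (∃ x ∈ F, ⟪x, p.1⟫ < p.2) → ⟪m, p.1⟫ < p.2 := by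
    have key : ∀ T ⊆ S, ∃ m ∈ F, ∀ p ∈ T, (∃ x ∈ F, ⟪x, p.1⟫ < p.2) → ⟪m, p.1⟫ < p.2 := by
      classical
      intro T
      induction T using Finset.induction_on with
      | empty => exact fun _ => ⟨x₀, hx₀, by simp⟩
      | insert q T _ ih =>
        intro hT
        obtain ⟨m, hm, hmT⟩ := ih ((Finset.subset_insert _ _).trans hT)
        by_cases hq : ∃ x ∈ F, ⟪x, q.1⟫ < q.2
        · obtain ⟨x, hx, hxq⟩ := hq
          refine ⟨midpoint ℝ m x, hconv.midpoint_mem hm hx, fun p hp hp' => ?_⟩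
          rw [midpoint_eq_smul_add, real_inner_smul_left, inner_add_left, invOf_eq_inv]
          have h1 := hFQ m hm p (hT hp)
          have h2 := hFQ x hx p (hT hp)
          rcases Finset.mem_insert.1 hp with rfl | hp
          · linarith
          · have := hmT p hp hp'
            linarith
        · refine ⟨m, hm, fun p hp hp' => ?_⟩
          rcases Finset.mem_insert.1 hp with rfl | hp
          · exact absurd hp' hq
          · exact hmT p hp hp'
    exact key S subset_rfl
  have hmQ := hm
  rw [hl] at hmQ
  refine IsCutOutBy.of_finite (S := (S : Set (E × ℝ)) ∪
    (fun p : E × ℝ => (-p.1, -p.2)) '' {p ∈ (S : Set (E × ℝ)) | ∀ x ∈ F, p.2 ≤ ⟪x, p.1⟫})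
    (S.finite_toSet.union ((S.finite_toSet.subset (Set.sep_subset _ _)).image _)) ?_ ?_
  · rintro p (hp | ⟨q, ⟨hq, -⟩, rfl⟩)
    · exact hSA p hp
    · exact hA _ (hSA q hq)
  intro x
  constructor
  · rintro hx p (hp | ⟨q, ⟨-, hq⟩, rfl⟩)
    · exact hFQ x hx p hp
    · rw [inner_neg_right]
      exact neg_le_neg (hq x hx)
  · intro hx
    have hxS : ∀ p ∈ S, ⟪x, p.1⟫ ≤ p.2 := fun p hp => hx p (Or.inl hp)
    rw [hl]
    refine ⟨hxS, fun y hy => (hmQ.2 y hy).trans ?_⟩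
    -- the segment from `x` to `m` can be prolonged within the polytope
    have ev : ∀ᶠ ε : ℝ in nhdsWithin 0 (Set.Ioi 0), ∀ p ∈ S, ⟪m + ε • (m - x), p.1⟫ ≤ p.2 := by
      rw [Filter.eventually_all_finset]
      intro p hp
      by_cases hp' : ∃ z ∈ F, ⟪z, p.1⟫ < p.2
      · have hc : Continuous fun ε : ℝ => ⟪m + ε • (m - x), p.1⟫ := by fun_prop
        have := (hc.tendsto 0).eventually_lt_const (u := p.2) (by simpa using hmS p hp hp')
        exact (this.filter_mono nhdsWithin_le_nhds).mono fun ε hε => hε.le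
      · push Not at hp'
        filter_upwards [self_mem_nhdsWithin] with ε (hε : 0 < ε)
        have h1 := hx _ (Or.inr ⟨p, ⟨hp, hp'⟩, rfl⟩)
        rw [inner_neg_right, neg_le_neg_iff] at h1
        have h2 := hFQ m hm p hp
        rw [inner_add_left, real_inner_smul_left, inner_sub_left]
        have := mul_nonneg hε.le (sub_nonneg.2 (h2.trans h1))
        linarith
    obtain ⟨ε, h1, hε⟩ := (ev.and self_mem_nhdsWithin).exists
    have h2 := hmQ.2 _ h1
    rw [map_add, map_smul, map_sub, smul_eq_mul] at h2
    have h3 : 0 < ε := hε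
    nlinarith

lemma IsFace.isExtreme {Q F : Set E} (h : IsFace Q F) : IsExtreme ℝ Q F := h.2.isExtreme

/-- A face of a polytope is the convex hull of its vertices. -/
lemma IsFace.eq_convexHull {V F : Set E} (hV : V.Finite) (h : IsFace (convexHull ℝ V) F) :
    (F.extremePoints ℝ).Finite ∧ (F.extremePoints ℝ).Nonempty ∧
      F = convexHull ℝ (F.extremePoints ℝ) := by
  have hfin : (F.extremePoints ℝ).Finite := hV.subset
    (h.isExtreme.extremePoints_subset_extremePoints.trans extremePoints_convexHull_subset)
  have heq : F = convexHull ℝ (F.extremePoints ℝ) := by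
    have h1 := closure_convexHull_extremePoints (h.2.isCompact (hV.isCompact_convexHull ℝ))
      (h.2.convex (convex_convexHull ℝ V))
    rw [(hfin.isClosed_convexHull ℝ).closure_eq] at h1
    exact h1.symm
  exact ⟨hfin, (convexHull_nonempty_iff (𝕜 := ℝ)).1 (heq ▸ h.1), heq⟩

end Faces

section Toric

variable {X E : Type*} [PartialOrder X] [Finite X] [NormedAddCommGroup E] [InnerProductSpace ℝ E]
  [FiniteDimensional ℝ E] {φ : X → E} {D : X → X → Submodule ℝ E} {u v : X}

/-- The polytope of an interval is cut out by inequalities that are equalities on the hyperplane of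
`[a, v]` or `[u, b]`, for an atom `a` or a coatom `b`, or on the affine span of the polytope. -/
theorem IsToricPoset.isCutOutBy (H : IsToricPoset φ D) (huv : u ≤ v) {A : Set E}
    (h0 : ∀ n ∈ (D u v)ᗮ, n ∈ A) (ha : ∀ a, u ⋖ a → a ≤ v → ∀ n ∈ (D a v)ᗮ, n ∈ A)
    (hb : ∀ b, u ≤ b → b ⋖ v → ∀ n ∈ (D u b)ᗮ, n ∈ A) :
    IsCutOutBy A (convexHull ℝ (φ '' Set.Icc u v)) := by
  obtain ⟨T, hT⟩ := IsNoetherian.noetherian (D u v)ᗮ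
  have hTD : ∀ n ∈ T, n ∈ (D u v)ᗮ := fun n hn => hT ▸ Submodule.subset_span hn
  have hexa : ∀ a : {a // u ⋖ a ∧ a ≤ v}, ∃ k ∈ (D a v)ᗮ, ⟪k, φ u⟫ < ⟪k, φ a⟫ :=
    fun a => H.exists_normal a.2.1 a.2.2
  have hexb : ∀ b : {b // u ≤ b ∧ b ⋖ v}, ∃ k ∈ (D u b)ᗮ, ⟪k, φ v⟫ < ⟪k, φ b⟫ :=
    fun b => H.dual.exists_normal b.2.2.toDual (OrderDual.toDual_le_toDual.2 b.2.1)
  choose ka hka hka' using hexa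
  choose kb hkb hkb' using hexb
  refine IsCutOutBy.of_finite (S := ((fun n => (n, ⟪n, φ u⟫)) '' T ∪
    (fun n => (-n, -⟪n, φ u⟫)) '' T) ∪
    (Set.range (fun a => (ka a, ⟪ka a, φ v⟫)) ∪ Set.range fun b => (kb b, ⟪kb b, φ u⟫)))
    (((T.finite_toSet.image _).union (T.finite_toSet.image _)).union
      ((Set.finite_range _).union (Set.finite_range _))) ?_ ?_
  · rintro _ ((⟨n, hn, rfl⟩ | ⟨n, hn, rfl⟩) | (⟨a, rfl⟩ | ⟨b, rfl⟩))
    · exact h0 _ (hTD n hn)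
    · exact h0 _ (neg_mem (hTD n hn))
    · exact ha a a.2.1 a.2.2 _ (hka a)
    · exact hb b b.2.1 b.2.2 _ (hkb b)
  intro y
  rw [H.mem_convexHull_iff huv]
  constructor
  · rintro ⟨h1, h2, h3⟩ _ ((⟨n, hn, rfl⟩ | ⟨n, hn, rfl⟩) | (⟨a, rfl⟩ | ⟨b, rfl⟩))
    · have := (Submodule.mem_orthogonal' _ _).1 (hTD n hn) _ h1
      rw [inner_sub_right] at this
      rw [real_inner_comm]
      linarith
    · have := (Submodule.mem_orthogonal' _ _).1 (hTD n hn) _ h1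
      rw [inner_sub_right] at this
      rw [real_inner_comm, inner_neg_left]
      linarith
    · rw [real_inner_comm]
      exact h2 a a.2.1 a.2.2 _ (hka a) (hka' a).le
    · rw [real_inner_comm]
      exact h3 b b.2.1 b.2.2 _ (hkb b) (hkb' b).le
  · intro hy
    have hyD : y - φ u ∈ D u v := by
      rw [← Submodule.orthogonal_orthogonal (D u v), ← hT, Submodule.mem_orthogonal]
      intro n hn
      induction hn using Submodule.span_induction with
      | mem n hn =>
        have h1 := hy _ (Or.inl (Or.inl ⟨n, hn, rfl⟩))
        have h2 := hy _ (Or.inl (Or.inr ⟨n, hn, rfl⟩))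
        rw [real_inner_comm] at h1
        rw [real_inner_comm, inner_neg_left] at h2
        rw [inner_sub_right]
        linarith
      | zero => exact inner_zero_left _
      | add m n _ _ hm hn => rw [inner_add_left, hm, hn, add_zero]
      | smul t n _ hn => rw [real_inner_smul_left, hn, mul_zero]
    refine ⟨hyD, fun a h1 h2 h hh hhu => ?_, fun b h1 h2 h hh hhv => ?_⟩
    · have := hy _ (Or.inr (Or.inl ⟨⟨a, h1, h2⟩, rfl⟩))
      rw [real_inner_comm] at this
      exact H.le_of_normal h1 h2 (hka ⟨a, h1, h2⟩) (hka' ⟨a, h1, h2⟩) hh hhu hyD this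
    · have := hy _ (Or.inr (Or.inr ⟨⟨b, h1, h2⟩, rfl⟩))
      rw [real_inner_comm] at this
      refine H.dual.le_of_normal h2.toDual (OrderDual.toDual_le_toDual.2 h1) (hkb ⟨b, h1, h2⟩)
        (hkb' ⟨b, h1, h2⟩) hh hhv ?_ this
      have := Submodule.sub_mem _ hyD (H.sub_mem huv)
      rwa [sub_sub_sub_cancel_right] at this

end Toric

/-! ### Intervals in the Weyl group as toric posets -/

section Interval

variable {ι E N : Type*} [AddCommGroup E] [Module ℝ E] [AddCommGroup N] [Module ℝ N]
  {P : RootPairing ι ℝ E N} {b : P.Base} {u v : P.weylGroup}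

/-- The Bruhat interval `[u, v]` as a type, ordered by the Bruhat order. -/
def Interval (b : P.Base) (u v : P.weylGroup) : Type _ := {x // x ∈ bruhatInterval b u v}

instance : PartialOrder (Interval b u v) where
  le x y := BruhatLE b x.1 y.1
  le_refl x := BruhatLE.refl b x.1
  le_trans _ _ _ h h' := BruhatLE.trans h h'
  le_antisymm _ _ h h' := Subtype.ext (BruhatLE.antisymm h h')

lemma finite_length_le [Finite ι] [P.IsCrystallographic] [P.IsReduced] (b : P.Base) (n : ℕ) :
    {w : P.weylGroup | length b w ≤ n}.Finite := by
  refine ((List.finite_length_le ι n).image (wordProd P)).subset fun w hw => ?_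
  obtain ⟨l, -, h, rfl⟩ := exists_reduced_word b w
  exact ⟨l, h.trans_le hw, rfl⟩

lemma finite_bruhatInterval [Finite ι] [P.IsCrystallographic] [P.IsReduced] :
    (bruhatInterval b u v).Finite :=
  (finite_length_le b (length b v)).subset fun _ hx => hx.2.length_le

instance [Finite ι] [P.IsCrystallographic] [P.IsReduced] : Finite (Interval b u v) :=
  finite_bruhatInterval.to_subtype

lemma Interval.step_of_covBy {x y : Interval b u v} (h : x ⋖ y) : BruhatStep b x.1 y.1 := by
  obtain ⟨z, h1, h2⟩ := BruhatLE.exists_step_left h.le fun he => h.ne (Subtype.ext he)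
  let z' : Interval b u v := ⟨z, x.2.1.trans h1.le, h2.trans y.2.2⟩
  have hxz : x < z' := lt_of_le_of_ne h1.le fun he =>
    h1.length_lt.ne (congrArg (fun t : Interval b u v => length b t.1) he)
  have hz : z' = y := (le_iff_lt_or_eq.1 (show z' ≤ y from h2)).resolve_left (h.2 hxz)
  rw [← hz]
  exact h1

variable [FiniteDimensional ℝ E]

lemma IsToric.covBy_of_step (ht : IsToric b u v) {x y : Interval b u v}
    (h : BruhatStep b x.1 y.1) : x ⋖ y := by
  have hl := ht.length_step x.2.1 h y.2.2
  refine ⟨lt_of_le_of_ne h.le fun he =>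
    h.length_lt.ne (congrArg (fun t : Interval b u v => length b t.1) he), fun z hxz hzy => ?_⟩
  have h1 := (BruhatLE.eq_or_length_lt (b := b) hxz.le).resolve_left
    fun he => hxz.ne (Subtype.ext he)
  have h2 := (BruhatLE.eq_or_length_lt (b := b) hzy.le).resolve_left
    fun he => hzy.ne (Subtype.ext he)
  omega

end Interval

section Toric

variable {ι E N : Type*} [NormedAddCommGroup E] [InnerProductSpace ℝ E]
  [AddCommGroup N] [Module ℝ N] {P : RootPairing ι ℝ E N} {b : P.Base} {u v : P.weylGroup}

lemma mov_translate (g x y : P.weylGroup) :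
    mov (g * y * (g * x)⁻¹) =
      (mov (y * x⁻¹)).map (DistribMulAction.toLinearEquiv ℝ E g : E →ₗ[ℝ] E) := by
  rw [← mov_conj]
  congr 1
  group

lemma mov_mul_ofIdx_mul_inv (g : P.weylGroup) (i : ι) :
    mov (g * ofIdx P i * g⁻¹) = Submodule.span ℝ {g • P.root i} := by
  rw [conj_ofIdx, mov_ofIdx, root_smul_idx]

lemma mul_ofIdx_smul (g : P.weylGroup) (i : ι) (x : E) :
    (g * ofIdx P i) • x = g • x - P.toLinearMap x (P.coroot i) • g • P.root i := by
  rw [mul_smul, ofIdx_smul_eq, smul_sub, smul_comm]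

lemma notMem_span_smul_root [P.IsReduced] {i j : ι} (hi : b.IsPos i) (hj : b.IsPos j)
    (hij : i ≠ j) (g : P.weylGroup) :
    g • P.root j ∉ Submodule.span ℝ {g • P.root i} := by
  intro h
  obtain ⟨t, ht⟩ := Submodule.mem_span_singleton.1 h
  rw [← smul_comm, smul_left_cancel_iff] at ht
  have h1 := LinearIndependent.pair_iff.1 (linearIndependent_of_isPos hi hj hij) t (-1)
    (by rw [ht, neg_one_smul, add_neg_cancel])
  norm_num at h1

variable [FiniteDimensional ℝ E]

lemma IsToric.isAtomCoatom (ht : IsToric b u v) {x a c y : P.weylGroup} (hux : BruhatLE b u x)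
    (hyv : BruhatLE b y v) (hxa : BruhatStep b x a) (hay : BruhatLE b a y) (hxc : BruhatLE b x c)
    (hcy : BruhatStep b c y) :
    ∃ i j, a = x * ofIdx P i ∧ c = y * ofIdx P j ∧ IsAtomCoatom b x y i j := by
  obtain ⟨i, hi, hai, -⟩ := hxa.exists_right_root
  obtain ⟨j, hj, -, hcj⟩ := hcy.exists_right_root
  subst hai hcj
  have hxy := hxa.le.trans hay
  exact ⟨i, j, rfl, rfl, (ht.right hux (hxy.trans hyv)).left hxy hyv, hi, hj, hxa, hay, hcy, hxc⟩

variable [Finite ι] [P.IsCrystallographic] [P.IsReduced]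

/-- A functional constant on `[a, v]`, for an atom `a`, and not smaller there than at `u`, is not
smaller at `v` than at any coatom. This is the geometric form of `IsAtomCoatom.eulerNonneg`. -/
lemma IsAtomCoatom.facet_atom
    (hP : ∀ (i : ι) (x y : E), ⟪P.reflection i x, P.reflection i y⟫ = ⟪x, y⟫)
    {lam : E} (hlam : IsRegularDominant b lam) {i j : ι} (H : IsAtomCoatom b u v i j)
    (g : P.weylGroup) {h : E} (hh : (g * v * (g * (u * ofIdx P i))⁻¹) • h = h)
    (hu : ⟪h, (g * u) • lam⟫ ≤ ⟪h, (g * (u * ofIdx P i)) • lam⟫) :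
    ⟪h, (g * (v * ofIdx P j)) • lam⟫ ≤ ⟪h, (g * v) • lam⟫ := by
  obtain ⟨k, hk, hk0⟩ := H.eulerNonneg hP
  have hli := hlam i H.pos_left
  have hlj := hlam j H.pos_right
  obtain ⟨l, hgh⟩ : ∃ l, h = (g * v) • l := ⟨(g * v)⁻¹ • h, (smul_inv_smul _ _).symm⟩
  have hfix : ((u * ofIdx P i)⁻¹ * v) • l = l := by
    apply smul_left_cancel (g * v)
    rw [← hgh]
    conv_rhs => rw [← hh, hgh]
    rw [smul_smul, smul_smul]
    congr 1
    group
  have hga : h = (g * (u * ofIdx P i)) • l := by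
    have : (g * (u * ofIdx P i)) • ((u * ofIdx P i)⁻¹ * v) • l = (g * v) • l := by
      rw [smul_smul]
      congr 1
      group
    rw [hfix] at this
    rw [this, ← hgh]
  have e1 : l - (u⁻¹ * v) • l = P.toLinearMap l (P.coroot i) • P.root i := by
    rw [inv_mul_eq_ofIdx_mul u v i]
    exact sub_ofIdx_mul_smul hfix i
  set s := P.toLinearMap l (P.coroot i) with hs
  have hfix2 : (u⁻¹ * v) • (l - s • k) = l - s • k := by
    have e2 : (u⁻¹ * v) • k = k - P.root i := by rw [← hk]; abel
    have e3 : (u⁻¹ * v) • l = l - s • P.root i := by rw [← e1]; abel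
    rw [smul_sub, smul_comm _ s k, e2, e3, smul_sub]
    abel
  have hj : P.root j ∈ mov (u⁻¹ * v) := by
    rw [(H.toric.mov_right H.le_right H.step_right.le).1]
    refine Submodule.mem_sup_right ?_
    have : (v * ofIdx P j)⁻¹ * v = ofIdx P j := by
      rw [mul_inv_rev, ofIdx_inv, inv_mul_cancel_right]
    rw [this]
    exact root_mem_mov j
  have e4 := inner_eq_zero_of_fixed hP hfix2 hj
  rw [inner_sub_left, real_inner_smul_left, sub_eq_zero] at e4
  -- the pairings with `lam`
  have e5 : ⟪h, (g * u) • lam⟫ = ⟪l, lam⟫ - P.toLinearMap lam (P.coroot i) * ⟪l, P.root i⟫ := by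
    have : (g * u) • lam = (g * (u * ofIdx P i)) • ofIdx P i • lam := by
      rw [smul_smul, ← mul_assoc, mul_ofIdx_cancel_right]
    rw [this, hga, inner_smul_smul hP, ofIdx_smul_eq, inner_sub_right, real_inner_smul_right]
  have e6 : ⟪h, (g * (u * ofIdx P i)) • lam⟫ = ⟪l, lam⟫ := by
    conv_lhs => rw [hga]
    rw [inner_smul_smul hP]
  have e7 : ⟪h, (g * v) • lam⟫ = ⟪l, lam⟫ := by
    conv_lhs => rw [hgh]
    rw [inner_smul_smul hP]
  have e8 : ⟪h, (g * (v * ofIdx P j)) • lam⟫ =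
      ⟪l, lam⟫ - P.toLinearMap lam (P.coroot j) * ⟪l, P.root j⟫ := by
    conv_lhs => rw [hgh, ← mul_assoc, mul_smul _ _ lam]
    rw [inner_smul_smul hP, ofIdx_smul_eq, inner_sub_right, real_inner_smul_right]
  rw [e5, e6] at hu
  rw [e7, e8, e4]
  have h1 : 0 ≤ ⟪l, P.root i⟫ := by
    by_contra hc
    push Not at hc
    have := mul_neg_of_pos_of_neg hli hc
    linarith
  have h2 : 0 ≤ s := by
    have h3 := coroot_mul_inner hP i l
    have h4 := inner_root_self_pos (P := P) i
    by_contra hc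
    push Not at hc
    have := mul_neg_of_neg_of_pos hc h4
    linarith
  have := mul_nonneg hlj.le (mul_nonneg h2 hk0)
  linarith

/-- The dual of `IsAtomCoatom.facet_atom`, which follows from the same sign. -/
lemma IsAtomCoatom.facet_coatom
    (hP : ∀ (i : ι) (x y : E), ⟪P.reflection i x, P.reflection i y⟫ = ⟪x, y⟫)
    {lam : E} (hlam : IsRegularDominant b lam) {i j : ι} (H : IsAtomCoatom b u v i j)
    (g : P.weylGroup) {h : E} (hh : (g * (v * ofIdx P j) * (g * u)⁻¹) • h = h)
    (hv : ⟪h, (g * v) • lam⟫ ≤ ⟪h, (g * (v * ofIdx P j)) • lam⟫) :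
    ⟪h, (g * (u * ofIdx P i)) • lam⟫ ≤ ⟪h, (g * u) • lam⟫ := by
  obtain ⟨k, hk, hk0⟩ := H.eulerNonneg hP
  have hli := hlam i H.pos_left
  have hlj := hlam j H.pos_right
  obtain ⟨l, hgh⟩ : ∃ l, h = (g * u) • l := ⟨(g * u)⁻¹ • h, (smul_inv_smul _ _).symm⟩
  have hgb : h = (g * (v * ofIdx P j)) • l := by
    conv_lhs => rw [← hh, hgh]
    rw [smul_smul, inv_mul_cancel_right]
  have hvl : (v⁻¹ * u) • l = ofIdx P j • l := by
    apply smul_left_cancel (g * v)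
    have h1 : (g * v) • (v⁻¹ * u) • l = (g * u) • l := by
      rw [smul_smul]
      congr 1
      group
    rw [h1, ← hgh, smul_smul, mul_assoc]
    exact hgb
  have e1 : ⟪l, P.root i⟫ = P.toLinearMap l (P.coroot j) * ⟪k, P.root j⟫ := by
    have h1 : ⟪l, (u⁻¹ * v) • k⟫ = ⟪(v⁻¹ * u) • l, k⟫ := by
      rw [inner_smul_eq hP, mul_inv_rev, inv_inv]
    rw [← hk, inner_sub_right, h1, hvl, ofIdx_smul_eq, inner_sub_left, real_inner_smul_left,
      real_inner_comm (P.root j)]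
    ring
  have e5 : ⟪h, (g * u) • lam⟫ = ⟪l, lam⟫ := by
    conv_lhs => rw [hgh]
    rw [inner_smul_smul hP]
  have e6 : ⟪h, (g * (u * ofIdx P i)) • lam⟫ =
      ⟪l, lam⟫ - P.toLinearMap lam (P.coroot i) * ⟪l, P.root i⟫ := by
    conv_lhs => rw [hgh, ← mul_assoc, mul_smul _ _ lam]
    rw [inner_smul_smul hP, ofIdx_smul_eq, inner_sub_right, real_inner_smul_right]
  have e7 : ⟪h, (g * (v * ofIdx P j)) • lam⟫ = ⟪l, lam⟫ := by
    conv_lhs => rw [hgb]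
    rw [inner_smul_smul hP]
  have e8 : ⟪h, (g * v) • lam⟫ = ⟪l, lam⟫ - P.toLinearMap lam (P.coroot j) * ⟪l, P.root j⟫ := by
    have : (g * v) • lam = (g * (v * ofIdx P j)) • ofIdx P j • lam := by
      rw [smul_smul, ← mul_assoc, mul_ofIdx_cancel_right]
    rw [this, hgb, inner_smul_smul hP, ofIdx_smul_eq, inner_sub_right, real_inner_smul_right]
  rw [e7, e8] at hv
  rw [e5, e6, e1]
  have h1 : 0 ≤ ⟪l, P.root j⟫ := by
    by_contra hc
    push Not at hc
    have := mul_neg_of_pos_of_neg hlj hc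
    linarith
  have h2 : 0 ≤ P.toLinearMap l (P.coroot j) := by
    have h3 := coroot_mul_inner hP j l
    have h4 := inner_root_self_pos (P := P) j
    by_contra hc
    push Not at hc
    have := mul_neg_of_neg_of_pos hc h4
    linarith
  have := mul_nonneg hli.le (mul_nonneg h2 hk0)
  linarith

/-- A toric Bruhat interval, translated by `g`, is a toric poset. -/
theorem IsToric.isToricPoset
    (hP : ∀ (i : ι) (x y : E), ⟪P.reflection i x, P.reflection i y⟫ = ⟪x, y⟫)
    {lam : E} (hlam : IsRegularDominant b lam) (ht : IsToric b u v) (g : P.weylGroup) :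
    IsToricPoset (X := Interval b u v) (fun x => (g * x.1) • lam)
      (fun x y => mov (g * y.1 * (g * x.1)⁻¹)) := by
  have hsub : ∀ {x y : Interval b u v}, x ≤ y → IsToric b x.1 y.1 := fun {x y} h =>
    (ht.right x.2.1 x.2.2).left h y.2.2
  have hD : ∀ (x : P.weylGroup) (i : ι), mov (g * (x * ofIdx P i) * (g * x)⁻¹) =
      Submodule.span ℝ {(g * x) • P.root i} := fun x i => by
    rw [← mov_mul_ofIdx_mul_inv, mul_assoc g x]
  have hφ : ∀ (x : P.weylGroup) (i : ι), (g * (x * ofIdx P i)) • lam - (g * x) • lam =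
      (-P.toLinearMap lam (P.coroot i)) • (g * x) • P.root i := fun x i => by
    rw [← mul_assoc, mul_ofIdx_smul, neg_smul]
    abel
  refine
    { sup := fun {x y z} h1 h2 => ?_
      disjoint := fun {x y z} h1 h2 => ?_
      sub_mem := fun {x y} _ => ?_
      covBy := fun {x y} h => ?_
      ne_of_covBy := fun {x y} h => ?_
      diamond := fun {x m y} h1 h2 => ?_
      atoms_indep := fun {x a a'} h1 h2 hne => ?_
      coatoms_indep := fun {y c c'} h1 h2 hne => ?_
      facet_atom := fun {x y a c} h1 h2 h3 h4 h hh hx => ?_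
      facet_coatom := fun {x y a c} h1 h2 h3 h4 h hh hy => ?_ }
  · rw [mov_translate, mov_translate, mov_translate, ← Submodule.map_sup,
      ((hsub (h1.trans h2)).mov_left h1 h2).1, sup_comm]
  · rw [mov_translate, mov_translate]
    exact (Submodule.disjoint_map (DistribMulAction.toLinearEquiv ℝ E g).injective
      ((hsub (h1.trans h2)).mov_left h1 h2).2).symm
  · have := smul_sub_mem_mov (g * y.1 * (g * x.1)⁻¹) ((g * x.1) • lam)
    rwa [smul_smul, inv_mul_cancel_right] at this
  · obtain ⟨i, hi, e, -⟩ := (Interval.step_of_covBy h).exists_right_root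
    have hne : -P.toLinearMap lam (P.coroot i) ≠ 0 := neg_ne_zero.2 (hlam i hi).ne'
    simp only [e]
    rw [hD, hφ, Submodule.span_singleton_smul_eq (IsUnit.mk0 _ hne)]
  · obtain ⟨i, hi, e, -⟩ := (Interval.step_of_covBy h).exists_right_root
    have hne : -P.toLinearMap lam (P.coroot i) ≠ 0 := neg_ne_zero.2 (hlam i hi).ne'
    simp only [e]
    rw [ne_comm, ← sub_ne_zero, hφ]
    exact smul_ne_zero hne ((smul_ne_zero_iff_ne _).2 (P.ne_zero i))
  · have s1 := Interval.step_of_covBy h1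
    have s2 := Interval.step_of_covBy h2
    have l1 := ht.length_step x.2.1 s1 m.2.2
    have l2 := ht.length_step m.2.1 s2 y.2.2
    obtain ⟨m', hne, s3, s4⟩ := exists_ne_middle s1 s2 (by omega)
    exact ⟨⟨m', x.2.1.trans s3.le, s4.le.trans y.2.2⟩, fun he => hne (congrArg Subtype.val he),
      ht.covBy_of_step s3, ht.covBy_of_step s4⟩
  · obtain ⟨i, hi, e, -⟩ := (Interval.step_of_covBy h1).exists_right_root
    obtain ⟨j, hj, e', -⟩ := (Interval.step_of_covBy h2).exists_right_root
    have hij : i ≠ j := by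
      rintro rfl
      exact hne (Subtype.ext (e.trans e'.symm))
    simp only [e, e']
    rw [hD, hφ, Submodule.smul_mem_iff _ (neg_ne_zero.2 (hlam j hj).ne')]
    exact notMem_span_smul_root hi hj hij _
  · obtain ⟨i, hi, -, e⟩ := (Interval.step_of_covBy h1).exists_right_root
    obtain ⟨j, hj, -, e'⟩ := (Interval.step_of_covBy h2).exists_right_root
    have hij : i ≠ j := by
      rintro rfl
      exact hne (Subtype.ext (e.trans e'.symm))
    have hD' : mov (g * y.1 * (g * (y.1 * ofIdx P i))⁻¹) =
        Submodule.span ℝ {(g * y.1) • P.root i} := by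
      rw [← hD, mul_inv_rev, mul_inv_rev, mul_inv_rev, ofIdx_inv]
      simp only [mul_assoc]
    simp only [e, e']
    rw [hD', hφ, Submodule.smul_mem_iff _ (neg_ne_zero.2 (hlam j hj).ne')]
    exact notMem_span_smul_root hi hj hij _
  · obtain ⟨i, j, e, e', H⟩ := ht.isAtomCoatom x.2.1 y.2.2 (Interval.step_of_covBy h1) h2 h3
      (Interval.step_of_covBy h4)
    simp only [e, e'] at hh hx ⊢
    exact H.facet_atom hP hlam g ((mem_mov_orthogonal hP).1 hh) hx
  · obtain ⟨i, j, e, e', H⟩ := ht.isAtomCoatom x.2.1 y.2.2 (Interval.step_of_covBy h1) h2 h3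
      (Interval.step_of_covBy h4)
    simp only [e, e'] at hh hy ⊢
    exact H.facet_coatom hP hlam g ((mem_mov_orthogonal hP).1 hh) hy

end Toric

/-! ### Coxeter elements -/

section Coxeter

variable {ι E N : Type*} [NormedAddCommGroup E] [InnerProductSpace ℝ E]
  [AddCommGroup N] [Module ℝ N] {P : RootPairing ι ℝ E N} {b : P.Base}

lemma bruhatLE_mul_wordProd [Finite ι] [P.IsCrystallographic] [P.IsReduced] (l : List ι)
    (hl : ∀ i ∈ l, i ∈ b.support) (w : P.weylGroup)
    (h : length b (w * wordProd P l) = length b w + l.length) :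
    BruhatLE b w (w * wordProd P l) := by
  induction l generalizing w with
  | nil => simpa [wordProd] using BruhatLE.refl b w
  | cons i l ih =>
    have hw : w * wordProd P (i :: l) = w * ofIdx P i * wordProd P l := by
      simp [wordProd, mul_assoc]
    have hl' : ∀ j ∈ l, j ∈ b.support := fun j hj => hl j (List.mem_cons_of_mem i hj)
    rw [hw, List.length_cons] at h
    rw [hw]
    have h1 := length_mul_le (b := b) (w * ofIdx P i) (wordProd P l)
    have h2 := length_le l hl'
    have h3 := length_mul_le (b := b) w (ofIdx P i)
    have h4 := length_simple_le (hl i List.mem_cons_self)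
    exact (bruhatStep_of_lt_mul_ofIdx (by omega)).le.trans (ih hl' _ (by omega))

lemma mov_wordProd_le (l : List ι) :
    mov (wordProd P l) ≤ Submodule.span ℝ (P.root '' {j | j ∈ l}) := by
  induction l with
  | nil => simp [wordProd, mov_one]
  | cons i l ih =>
    have : wordProd P (i :: l) = ofIdx P i * wordProd P l := by simp [wordProd]
    rw [this]
    refine (mov_mul_le _ _).trans (sup_le ?_ (ih.trans (Submodule.span_mono
      (Set.image_mono fun j hj => List.mem_cons_of_mem i hj))))
    rw [mov_ofIdx, Submodule.span_singleton_le_iff_mem]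
    exact Submodule.subset_span ⟨i, List.mem_cons_self, rfl⟩

lemma root_notMem_span_of_notMem {i : ι} {l : List ι} (hi : i ∈ b.support)
    (hl : ∀ j ∈ l, j ∈ b.support) (h : i ∉ l) :
    P.root i ∉ Submodule.span ℝ (P.root '' {j | j ∈ l}) :=
  (b.linearIndepOn_root.mono (Set.insert_subset hi hl)).notMem_span_of_insert h

variable [FiniteDimensional ℝ E]

/-- The moved space of a product of distinct simple reflections contains each of their roots: since
simple roots are linearly independent, a fixed vector of the product is orthogonal to all of
them. -/
lemma root_mem_mov_wordProd
    (hP : ∀ (i : ι) (x y : E), ⟪P.reflection i x, P.reflection i y⟫ = ⟪x, y⟫)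
    {l : List ι} (hl : ∀ i ∈ l, i ∈ b.support) (hnd : l.Nodup) :
    ∀ j ∈ l, P.root j ∈ mov (wordProd P l) := by
  induction l with
  | nil => simp
  | cons i l ih =>
    have hw : wordProd P (i :: l) = ofIdx P i * wordProd P l := by simp [wordProd]
    have hl' : ∀ j ∈ l, j ∈ b.support := fun j hj => hl j (List.mem_cons_of_mem i hj)
    obtain ⟨hil, hnd'⟩ := List.nodup_cons.1 hnd
    have hfix : ∀ x ∈ (mov (wordProd P (i :: l)))ᗮ,
        x ∈ (mov (wordProd P l))ᗮ ∧ ⟪x, P.root i⟫ = 0 := by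
      intro x hx
      rw [mem_mov_orthogonal hP, hw, mul_smul] at hx
      have h1 : wordProd P l • x = x - P.toLinearMap x (P.coroot i) • P.root i := by
        rw [← ofIdx_smul_eq]
        conv_rhs => rw [← hx]
        rw [smul_smul, ofIdx_mul_self, one_smul]
      have h2 : P.toLinearMap x (P.coroot i) = 0 := by
        by_contra hne
        have h3 := sub_smul_mem_mov (wordProd P l) x
        rw [h1, sub_sub_cancel, Submodule.smul_mem_iff _ hne] at h3
        exact root_notMem_span_of_notMem (hl i List.mem_cons_self) hl' hil (mov_wordProd_le l h3)
      have h4 := coroot_mul_inner hP i x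
      rw [h2, zero_smul, sub_zero] at h1
      exact ⟨(mem_mov_orthogonal hP).2 h1, by rw [h2, zero_mul] at h4; linarith⟩
    intro j hj
    rw [← Submodule.orthogonal_orthogonal (mov (wordProd P (i :: l))), Submodule.mem_orthogonal]
    intro x hx
    obtain ⟨h1, h2⟩ := hfix x hx
    rcases List.mem_cons.1 hj with rfl | hj
    · exact h2
    · exact (Submodule.mem_orthogonal' _ _).1 h1 _ (ih hl' hnd' j hj)

lemma IsCoxeterElement.length_le_finrank_mov
    (hP : ∀ (i : ι) (x y : E), ⟪P.reflection i x, P.reflection i y⟫ = ⟪x, y⟫)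
    {c : P.weylGroup} (hc : IsCoxeterElement b c) :
    length b c ≤ Module.finrank ℝ (mov c) := by
  classical
  obtain ⟨l, hnd, hl, rfl⟩ := hc
  refine (length_le l fun i hi => (hl i).1 hi).trans ?_
  have hmem := root_mem_mov_wordProd hP (fun i hi => (hl i).1 hi) hnd
  have hli : LinearIndependent ℝ (fun i : b.support =>
      (⟨P.root i, hmem i ((hl i).2 i.2)⟩ : mov (wordProd P l))) :=
    LinearIndependent.of_comp (Submodule.subtype _) b.linearIndepOn_root
  have hcard : l.length = b.support.card := by
    rw [← List.toFinset_card_of_nodup hnd]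
    congr 1
    ext i
    rw [List.mem_toFinset, hl]
  rw [hcard, ← Fintype.card_coe]
  exact hli.fintype_card_le_finrank

variable [Finite ι] [P.IsCrystallographic] [P.IsReduced]

/-- The intervals of the moment complex are toric, as the length of a Coxeter element `c` is the
dimension of its moved space. -/
theorem IsCoxeterElement.isToric
    (hP : ∀ (i : ι) (x y : E), ⟪P.reflection i x, P.reflection i y⟫ = ⟪x, y⟫)
    {c : P.weylGroup} (hc : IsCoxeterElement b c) {w : P.weylGroup}
    (hw : length b (w * c) = length b w + length b c) : IsToric b w (w * c) := by
  constructor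
  · obtain ⟨l, hl, h, rfl⟩ := exists_reduced_word b c
    exact bruhatLE_mul_wordProd l hl w (by rw [hw, h])
  · rw [hw, inv_mul_cancel_left]
    exact Nat.add_le_add_left (hc.length_le_finrank_mov hP) _

end Coxeter

/-! ### The moment complex -/

section Permutahedron

variable {ι E N : Type*} [NormedAddCommGroup E] [InnerProductSpace ℝ E]
  [AddCommGroup N] [Module ℝ N] {P : RootPairing ι ℝ E N}

/-- All points of the orbit are vertices of the permutahedron, since they lie on a sphere. -/
lemma range_smul_subset_extremePoints
    (hP : ∀ (i : ι) (x y : E), ⟪P.reflection i x, P.reflection i y⟫ = ⟪x, y⟫) (lam : E) :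
    Set.range (fun x : P.weylGroup => x • lam) ⊆ (permutahedron P lam).extremePoints ℝ := by
  have hnorm : ∀ x : P.weylGroup, ‖x • lam‖ = ‖lam‖ := fun x => by
    rw [norm_eq_sqrt_real_inner, norm_eq_sqrt_real_inner, inner_smul_smul hP]
  have hball : permutahedron P lam ⊆ Metric.closedBall 0 ‖lam‖ := by
    refine convexHull_min ?_ (convex_closedBall _ _)
    rintro _ ⟨x, rfl⟩
    rw [mem_closedBall_zero_iff, hnorm]
  rintro _ ⟨x, rfl⟩
  refine inter_extremePoints_subset_extremePoints_of_subset hball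
    ⟨subset_convexHull _ _ ⟨x, rfl⟩, ?_⟩
  rcases eq_or_ne lam 0 with rfl | hlam
  · simp
  · refine StrictConvexSpace.sphere_subset_extremePoints_closedBall 0 (norm_ne_zero_iff.2 hlam) ?_
    rw [mem_sphere_zero_iff_norm, hnorm]

end Permutahedron

section MomentComplex

variable {ι E N : Type*} [NormedAddCommGroup E] [InnerProductSpace ℝ E]
  [AddCommGroup N] [Module ℝ N] {P : RootPairing ι ℝ E N} {b : P.Base}

/-- The vectors `n` for which `n - c • n` is zero or a multiple of a root: the normals allowed for
a polypositroid. -/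
def polypositroidNormals (c : P.weylGroup) : Set E :=
  {n | n - c • n = 0 ∨ ∃ (i : ι) (r : ℝ), n - c • n = r • P.root i}

lemma neg_mem_polypositroidNormals {c : P.weylGroup} {n : E} (h : n ∈ polypositroidNormals c) :
    -n ∈ polypositroidNormals c := by
  have e : -n - c • -n = -(n - c • n) := by rw [smul_neg]; abel
  rcases h with h | ⟨i, r, h⟩
  · exact Or.inl (by rw [e, h, neg_zero])
  · exact Or.inr ⟨i, -r, by rw [e, h, neg_smul]⟩

/-- The normals of the facets of the moment complex are fixed by `c r_i`, for some root `i`. -/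
lemma mem_polypositroidNormals_of_fixed {c : P.weylGroup} {n : E} {i : ι}
    (h : (c * ofIdx P i) • n = n) : n ∈ polypositroidNormals c := by
  refine Or.inr ⟨c • i, -P.toLinearMap n (P.coroot i), ?_⟩
  rw [mul_ofIdx_smul] at h
  rw [root_smul_idx, neg_smul]
  nth_rewrite 1 [← h]
  abel

lemma smul_bruhatPolytope (lam : E) (u v : P.weylGroup) (huv : BruhatLE b u v) (g : P.weylGroup) :
    g • bruhatPolytope b lam u v = convexHull ℝ ((fun x : Interval b u v => (g * x.1) • lam) ''
      Set.Icc ⟨u, BruhatLE.refl b u, huv⟩ ⟨v, huv, BruhatLE.refl b v⟩) := by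
  have h := (DistribSMul.toLinearMap ℝ E g).image_convexHull
    ((fun x : P.weylGroup => x • lam) '' bruhatInterval b u v)
  rw [← Set.image_smul]
  refine h.trans (congrArg _ ?_)
  rw [Set.image_image]
  ext y
  constructor
  · rintro ⟨x, hx, rfl⟩
    exact ⟨⟨x, hx⟩, ⟨hx.1, hx.2⟩, mul_smul _ _ _⟩
  · rintro ⟨x, -, rfl⟩
    exact ⟨x.1, x.2, (mul_smul _ _ _).symm⟩

variable [Finite ι] [P.IsCrystallographic] [P.IsReduced] [FiniteDimensional ℝ E]

/-- The polytopes of the moment complex are cut out by inequalities with the allowed normals. -/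
lemma isCutOutBy_smul_bruhatPolytope
    (hP : ∀ (i : ι) (x y : E), ⟪P.reflection i x, P.reflection i y⟫ = ⟪x, y⟫)
    {lam : E} (hlam : IsRegularDominant b lam) {c : P.weylGroup} {w : P.weylGroup}
    (ht : IsToric b w (w * c)) :
    IsCutOutBy (polypositroidNormals c) (w⁻¹ • bruhatPolytope b lam w (w * c)) := by
  rw [smul_bruhatPolytope lam w (w * c) ht.le]
  refine (ht.isToricPoset hP hlam w⁻¹).isCutOutBy ht.le (fun n hn => ?_)
    (fun a h1 _ n hn => ?_) (fun a _ h2 n hn => ?_)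
  · rw [mem_mov_orthogonal hP] at hn
    refine Or.inl (sub_eq_zero.2 ?_)
    simpa using hn.symm
  · obtain ⟨i, -, e, -⟩ := (Interval.step_of_covBy h1).exists_right_root
    rw [mem_mov_orthogonal hP, e] at hn
    refine mem_polypositroidNormals_of_fixed (i := i) ?_
    simpa [mul_smul, ofIdx_inv] using hn
  · obtain ⟨i, -, -, e⟩ := (Interval.step_of_covBy h2).exists_right_root
    rw [mem_mov_orthogonal hP, e] at hn
    refine mem_polypositroidNormals_of_fixed (i := i) ?_
    simpa [mul_smul, mul_assoc] using hn

lemma exists_root_of_isExtreme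
    (hP : ∀ (i : ι) (x y : E), ⟪P.reflection i x, P.reflection i y⟫ = ⟪x, y⟫)
    {lam : E} (hlam : IsRegularDominant b lam) {u v : P.weylGroup} (ht : IsToric b u v)
    (g : P.weylGroup) {x y : E} (hxy : x ≠ y)
    (hS : IsExtreme ℝ (g • bruhatPolytope b lam u v) (segment ℝ x y)) :
    ∃ (i : ι) (r : ℝ), y - x = r • P.root i := by
  rw [smul_bruhatPolytope lam u v ht.le] at hS
  obtain ⟨p, q, hpq, h⟩ := (ht.isToricPoset hP hlam g).exists_covBy_of_isExtreme ht.le hxy hS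
  obtain ⟨i, -, e, -⟩ := (Interval.step_of_covBy hpq).exists_right_root
  simp only [e] at h
  rw [← mul_assoc, mov_mul_ofIdx_mul_inv] at h
  obtain ⟨r, hr⟩ := Submodule.mem_span_singleton.1 h
  exact ⟨(g * p.1) • i, r, by rw [root_smul_idx, hr]⟩

end MomentComplex

end CoxeterFlag

open CoxeterFlag in
theorem theorem7p5 {ι E N : Type*} [Finite ι]
    [NormedAddCommGroup E] [InnerProductSpace ℝ E] [FiniteDimensional ℝ E]
    [AddCommGroup N] [Module ℝ N]
    (P : RootPairing ι ℝ E N) [P.IsCrystallographic] [P.IsReduced]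
    (hP : ∀ (i : ι) (x y : E), ⟪P.reflection i x, P.reflection i y⟫ = ⟪x, y⟫)
    (b : P.Base) (lam : E) (hlam : CoxeterFlag.IsRegularDominant b lam)
    (c : P.weylGroup) (hc : CoxeterFlag.IsCoxeterElement b c) :
    ∀ Q ∈ CoxeterFlag.momentComplex b lam c, ∀ F : Set E, CoxeterFlag.IsFace Q F →
      CoxeterFlag.IsPolypositroid lam c F := by
  rintro Q ⟨w, hw, hQ⟩ F hF
  have ht := hc.isToric hP hw
  have hcut := ((isCutOutBy_smul_bruhatPolytope hP hlam ht).of_isFace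
    (fun _ => neg_mem_polypositroidNormals) hQ).of_isFace
    (fun _ => neg_mem_polypositroidNormals) hF
  have hext := hQ.isExtreme.trans hF.isExtreme
  have hV : ∀ S : Set (Interval b w (w * c)), (fun x => (w⁻¹ * x.1) • lam) '' S ⊆
      Set.range fun x : P.weylGroup => x • lam := by
    rintro S _ ⟨x, -, rfl⟩
    exact ⟨w⁻¹ * x.1, rfl⟩
  refine ⟨⟨?_, ?_, ?_, ?_⟩, hcut⟩
  · rw [smul_bruhatPolytope lam w (w * c) ht.le] at hQ
    obtain ⟨hfin, -, heq⟩ := hQ.eq_convexHull (Set.toFinite _)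
    rw [heq] at hF
    obtain ⟨hfin', hne, heq'⟩ := hF.eq_convexHull hfin
    exact ⟨_, hfin', hne, heq'⟩
  · refine hext.1.trans ?_
    rw [smul_bruhatPolytope lam w (w * c) ht.le]
    exact convexHull_mono (hV _)
  · refine hext.extremePoints_subset_extremePoints.trans ?_
    rw [smul_bruhatPolytope lam w (w * c) ht.le]
    exact (extremePoints_convexHull_subset.trans (hV _)).trans
      (range_smul_subset_extremePoints hP lam)
  · exact fun x y hxy hS => exists_root_of_isExtreme hP hlam ht w⁻¹ hxy (hext.trans hS.isExtreme)
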